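/- Let $X$ and $U$ be (real or complex) Banach lattices with positive cones $X^+,U^+$, and let $\partial X$ be a Banach space over the same scalar field. Let $A_m:D(A_m)\subseteq X\to X$ be a closed, densely defined operator, let $Q:D(A_m)\to\partial X$ be linear, surjective and bounded for the graph norm of $A_m$, and let $B\in\mathcal L(U,\partial X)$. Assume that the restriction $A$ of $A_m$ to $D(A)=\ker Q$ generates a strongly continuous semigroup $(T(t))_{t\ge0}$ on $X$, with growth bound $\omega_0(A)\in[-\infty,\infty)$. For $\lambda\in\rho(A)$ let $R(\lambda,A)=(\lambda-A)^{-1}$, let $Q_\lambda:=(Q|_{\ker(\lambda-A_m)})^{-1}:\partial X\to\ker(\lambda-A_m)\subseteq X$ and $B_\lambda:=Q_\lambda B$. Let $1\le p\le\infty$ and assume that $B$ is $p$-boundary admissible: there are $t>0$ and $\lambda\in\rho(A)$ with $\int_0^tT(t-s)B_\lambda u(s)\,ds\in D(A)$ for all $u\in L^p([0,t],U)$. (This then holds for all $t\ge 0$ and all $\lambda\in\rho(A)$.) For $t\ge0$ and $u\in L^p([0,t],U)$ put $\mathcal B_tu:=(\lambda-A)\int_0^tT(t-s)B_\lambda u(s)\,ds$,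 which does not depend on $\lambda\in\rho(A)$, and let $$e^+\mathcal R_t:=\{\mathcal B_tu:\ u\in L^p([0,t],U),\ u(s)\in U^+\text{ for a.e. }s\},\qquad a^+\mathcal R:=\overline{\bigcup_{t\ge0}\overline{e^+\mathcal R_t}}.$$ Assume that $e^+\mathcal R_{t_0}\subseteq X^+$ for some $t_0>0$. Then the following holds, where $\overline{\operatorname{co}}$ denotes the closed convex hull in $X$. (i) $a^+\mathcal R$ is a closed convex cone (a closed convex set containing $0$ and stable under multiplication by reals $c\ge0$), invariant under $T(t)$ for all $t\ge0$ and under $R(\lambda,A)$ for all real $\lambda>\omega_0(A)$. (ii) For every real $\lambda>\omega_0(A)$, $$a^+\mathcal R=\overline{\operatorname{co}}\,\bigl\{\bigl(e^{\lambda\beta}T(t-\beta)-e^{\lambda\alpha}T(t-\alpha)\bigr)B_\lambda v:\ 0\le\alpha\le\beta\le t,\ v\in U^+\bigr\},$$ where $t\ge0$ varies as well. (iii) For every real $w>\omega_0(A)$, $$a^+\mathcal R=\overline{\operatorname{co}}\,\{T(t)B_\lambda v:\ t\ge0,\ \lambda>w,\ v\in U^+\}.$$ (iv) For every real $w>\omega_0(A)$,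 $$a^+\mathcal R=\overline{\operatorname{co}}\,\{R(\lambda,A)^nB_\lambda v:\ n\in\{0,1,2,\dots\},\ \lambda>w,\ v\in U^+\}.$$ -/

import Mathlib

open MeasureTheory Filter Set
open scoped Topology ENNReal

/-- Banach lattices over `𝕜 = ℝ` or `𝕜 = ℂ`. For a real Banach lattice `Er` this structure says that
the `𝕜`-Banach space `E` is `Er` itself (`𝕜 = ℝ`) or the complexification `Er ⊕ i Er` with norm
`‖z‖ = ‖|z|‖`, where `|z| = sup {re (c z) : |c| = 1}` is the modulus of `z` (`𝕜 = ℂ`).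
Here `ofReal` embeds the real elements and `re` takes the real part; as `im z = - re (i z)`, the
field `decomp` is `z = re z + i im z` (and `z = re z` if `𝕜 = ℝ`, where `RCLike.I = 0`). -/
structure BanachLatticeOver (𝕜 E Er : Type*) [RCLike 𝕜]
    [NormedAddCommGroup E] [NormedSpace 𝕜 E] [NormedSpace ℝ E] [IsScalarTower ℝ 𝕜 E]
    [NormedAddCommGroup Er] [Lattice Er] [IsOrderedAddMonoid Er] [HasSolidNorm Er]
    [NormedSpace ℝ Er] [IsOrderedModule ℝ Er] where
  ofReal : Er →ₗ[ℝ] E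
  re : E →ₗ[ℝ] Er
  re_ofReal : ∀ x, re (ofReal x) = x
  re_I_smul_ofReal : ∀ x, re ((RCLike.I : 𝕜) • ofReal x) = 0
  decomp : ∀ z, z = ofReal (re z) - (RCLike.I : 𝕜) • ofReal (re ((RCLike.I : 𝕜) • z))
  norm_eq : ∀ z, ∃ m : Er, IsLUB {r : Er | ∃ c : 𝕜, ‖c‖ = 1 ∧ r = re (c • z)} m ∧ ‖z‖ = ‖m‖

/-- The positive cone `E⁺` of a Banach lattice. -/
def BanachLatticeOver.posCone {𝕜 E Er : Type*} [RCLike 𝕜]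
    [NormedAddCommGroup E] [NormedSpace 𝕜 E] [NormedSpace ℝ E] [IsScalarTower ℝ 𝕜 E]
    [NormedAddCommGroup Er] [Lattice Er] [IsOrderedAddMonoid Er] [HasSolidNorm Er]
    [NormedSpace ℝ Er] [IsOrderedModule ℝ Er] (L : BanachLatticeOver 𝕜 E Er) : Set E :=
  {z | ∃ r : Er, 0 ≤ r ∧ z = L.ofReal r}

section Semigroups

variable {𝕜 X : Type*} [RCLike 𝕜] [NormedAddCommGroup X] [NormedSpace 𝕜 X]

/-- `(T t)`, `t ≥ 0`, is a strongly continuous semigroup; the values for `t < 0` are irrelevant. -/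
structure IsC0Semigroup (T : ℝ → X →L[𝕜] X) : Prop where
  map_zero : T 0 = ContinuousLinearMap.id 𝕜 X
  map_add : ∀ s t : ℝ, 0 ≤ s → 0 ≤ t → T (s + t) = (T s).comp (T t)
  strongly_continuous : ∀ x : X, ContinuousOn (fun t => T t x) (Ici 0)

/-- `A` (with its domain) is the generator of `(T t)`, `t ≥ 0`. -/
def IsGenerator [NormedSpace ℝ X] (A : X →ₗ.[𝕜] X) (T : ℝ → X →L[𝕜] X) : Prop :=
  ∀ x y : X, (x, y) ∈ A.graph ↔
    Tendsto (fun h : ℝ => h⁻¹ • (T h x - x)) (𝓝[>] 0) (𝓝 y)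

/-- The growth bound `ω₀ ∈ [-∞, ∞]`: the infimum of all real `w` for which there is a constant `M`
with `‖T t‖ ≤ M e ^ (w t)` for all `t ≥ 0`. -/
noncomputable def growthBound (T : ℝ → X →L[𝕜] X) : EReal :=
  sInf ((fun w : ℝ => (w : EReal)) ''
    {w : ℝ | ∃ M : ℝ, ∀ t : ℝ, 0 ≤ t → ‖T t‖ ≤ M * Real.exp (w * t)})

/-- The bounded operator `R` is a two-sided inverse of `lam - A : D(A) → X`. -/
def IsResolventAt (A : X →ₗ.[𝕜] X) (lam : 𝕜) (R : X →L[𝕜] X) : Prop :=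
  (∀ x : X, (R x, lam • R x - x) ∈ A.graph) ∧
    ∀ y : A.domain, R (lam • (y : X) - A y) = (y : X)

/-- The resolvent set `ρ(A)`. -/
def resolventSetOf (A : X →ₗ.[𝕜] X) : Set 𝕜 :=
  {lam | ∃ R : X →L[𝕜] X, IsResolventAt A lam R}

open Classical in
/-- The resolvent `R(lam, A) = (lam - A)⁻¹` for `lam ∈ ρ(A)` (and `0` otherwise). -/
noncomputable def resolventOp (A : X →ₗ.[𝕜] X) (lam : 𝕜) : X →L[𝕜] X :=
  if h : ∃ R : X →L[𝕜] X, IsResolventAt A lam R then h.choose else 0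

theorem resolventOp_spec {A : X →ₗ.[𝕜] X} {lam : 𝕜} (h : lam ∈ resolventSetOf A) :
    IsResolventAt A lam (resolventOp A lam) := by
  have h' : ∃ R : X →L[𝕜] X, IsResolventAt A lam R := h
  unfold resolventOp
  rw [dif_pos h']
  exact h'.choose_spec

end Semigroups

/-- A boundary control system: the maximal system operator `Am`, the boundary operator `Q`
(bounded on `D(Am)` with the graph norm) and the control operator `B`, such that `Q` is surjective
and the restriction of `Am` to `ker Q` generates the strongly continuous semigroup `T`. -/
structure BoundaryControlSystem (𝕜 X dX U : Type*) [RCLike 𝕜]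
    [NormedAddCommGroup X] [NormedSpace 𝕜 X] [NormedSpace ℝ X]
    [NormedAddCommGroup dX] [NormedSpace 𝕜 dX]
    [NormedAddCommGroup U] [NormedSpace 𝕜 U] where
  Am : X →ₗ.[𝕜] X
  Am_closed : Am.IsClosed
  Am_dense : Dense (Am.domain : Set X)
  Q : Am.domain →ₗ[𝕜] dX
  Q_bounded : ∃ C : ℝ, ∀ x : Am.domain, ‖Q x‖ ≤ C * (‖(x : X)‖ + ‖Am x‖)
  Q_surjective : Function.Surjective Q
  B : U →L[𝕜] dX
  T : ℝ → X →L[𝕜] X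
  T_semigroup : IsC0Semigroup T
  T_generator : IsGenerator (Am.domRestrict ((LinearMap.ker Q).map Am.domain.subtype)) T

namespace BoundaryControlSystem

variable {𝕜 X dX U : Type*} [RCLike 𝕜]
  [NormedAddCommGroup X] [NormedSpace 𝕜 X] [NormedSpace ℝ X]
  [NormedAddCommGroup dX] [NormedSpace 𝕜 dX]
  [NormedAddCommGroup U] [NormedSpace 𝕜 U]
  (S : BoundaryControlSystem 𝕜 X dX U)

/-- The restriction `A` of `Am` with domain `D(A) = ker Q`. -/
noncomputable def A : X →ₗ.[𝕜] X :=
  S.Am.domRestrict ((LinearMap.ker S.Q).map S.Am.domain.subtype)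

/-- For `lam ∈ ρ(A)` the restriction of `Q` to `ker (lam - Am)` is a bijection onto the boundary
space, so that the Dirichlet operator below is well defined. -/
theorem existsUnique_dirichlet {lam : 𝕜} (h : lam ∈ resolventSetOf S.A) (d : dX) :
    ∃! x : S.Am.domain, S.Am x = lam • (x : X) ∧ S.Q x = d := by
  have memA : ∀ z : S.Am.domain, S.Q z = 0 → ∃ hz : (z : X) ∈ S.A.domain,
      S.A ⟨z, hz⟩ = S.Am z := by
    intro z hz
    have hm : (z : X) ∈ S.A.domain :=
      ⟨Submodule.mem_map.2 ⟨z, LinearMap.mem_ker.2 hz, rfl⟩, z.2⟩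
    exact ⟨hm, LinearPMap.domRestrict_apply rfl⟩
  have hR := resolventOp_spec h
  obtain ⟨x₀, hx₀⟩ := S.Q_surjective d
  have hg := hR.1 (lam • (x₀ : X) - S.Am x₀)
  rw [LinearPMap.mem_graph_iff] at hg
  obtain ⟨y, hy1, hy2⟩ := hg
  dsimp only at hy1 hy2
  have hyd : (y : X) ∈ S.Am.domain := y.2.2
  have hyA : S.A y = S.Am ⟨y, hyd⟩ := LinearPMap.domRestrict_apply rfl
  have hyQ : S.Q ⟨y, hyd⟩ = 0 := by
    obtain ⟨z, hz, hzy⟩ := Submodule.mem_map.1 y.2.1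
    have : (⟨y, hyd⟩ : S.Am.domain) = z := Subtype.ext hzy.symm
    rw [this]
    exact LinearMap.mem_ker.1 hz
  refine ⟨x₀ - ⟨y, hyd⟩, ⟨?_, ?_⟩, ?_⟩
  · rw [LinearPMap.map_sub, ← hyA, hy2, ← hy1]
    simp only [AddSubgroupClass.coe_sub, smul_sub]
    abel
  · rw [map_sub, hx₀, hyQ, sub_zero]
  · rintro x' ⟨h1, h2⟩
    obtain ⟨hz, hz'⟩ := memA (x' - (x₀ - ⟨y, hyd⟩)) (by
      rw [map_sub, map_sub, h2, hx₀, hyQ]; simp)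
    have h3 := hR.2 ⟨_, hz⟩
    have h4 : S.Am (x₀ - ⟨y, hyd⟩) = lam • ((x₀ - ⟨y, hyd⟩ : S.Am.domain) : X) := by
      rw [LinearPMap.map_sub, ← hyA, hy2, ← hy1]
      simp only [AddSubgroupClass.coe_sub, smul_sub]
      abel
    rw [hz', LinearPMap.map_sub, h1, h4] at h3
    have h5 : ((x' - (x₀ - ⟨y, hyd⟩) : S.Am.domain) : X) = 0 := by
      rw [← h3]
      simp only [AddSubgroupClass.coe_sub, smul_sub]
      simp
    exact sub_eq_zero.1 (Subtype.ext h5)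

open Classical in
/-- The Dirichlet operator `Q_lam = (Q restricted to ker (lam - Am))⁻¹` for `lam ∈ ρ(A)`. -/
noncomputable def dirichlet (lam : 𝕜) (d : dX) : X :=
  if h : ∃ x : S.Am.domain, S.Am x = lam • (x : X) ∧ S.Q x = d then (h.choose : X) else 0

/-- The operator `B_lam = Q_lam B`. -/
noncomputable def Bop (lam : 𝕜) (v : U) : X := S.dirichlet lam (S.B v)

/-- The integral `∫₀ᵗ T(t - s) B_lam u(s) ds`. -/
noncomputable def inputIntegral (lam : 𝕜) (t : ℝ) (u : ℝ → U) : X :=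
  ∫ s in (0 : ℝ)..t, S.T (t - s) (S.Bop lam (u s))

/-- `p`-boundary admissibility of the control operator. -/
def IsBoundaryAdmissible (p : ℝ≥0∞) : Prop :=
  ∃ t : ℝ, 0 < t ∧ ∃ lam ∈ resolventSetOf S.A, ∀ u : ℝ → U,
    MemLp u p (volume.restrict (Icc 0 t)) → S.inputIntegral lam t u ∈ S.A.domain

/-- `x` is the value `(lam - A) ∫₀ᵗ T(t - s) B_lam u(s) ds` of the controllability map at `u`
(in particular, the integral belongs to `D(A)`). -/
def IsControllabilityValue (lam : 𝕜) (t : ℝ) (u : ℝ → U) (x : X) : Prop :=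
  ∃ h : S.inputIntegral lam t u ∈ S.A.domain,
    x = lam • S.inputIntegral lam t u - S.A ⟨S.inputIntegral lam t u, h⟩

/-- The exact positive reachability space in time `t`: all values of the controllability map at
controls `u ∈ Lᵖ([0, t], U⁺)`, where `Upos` is the positive cone `U⁺`. The controllability map does
not depend on the choice of `lam ∈ ρ(A)`. -/
def exactPosReach (p : ℝ≥0∞) (Upos : Set U) (t : ℝ) : Set X :=
  {x | ∃ lam ∈ resolventSetOf S.A, ∃ u : ℝ → U, MemLp u p (volume.restrict (Icc 0 t)) ∧
    (∀ᵐ s ∂(volume.restrict (Icc 0 t)), u s ∈ Upos) ∧ S.IsControllabilityValue lam t u x}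

/-- The approximate positive reachability space in time `t`. -/
def approxPosReachAt (p : ℝ≥0∞) (Upos : Set U) (t : ℝ) : Set X :=
  closure (S.exactPosReach p Upos t)

/-- The approximate positive reachability space (in arbitrary time). -/
def approxPosReach (p : ℝ≥0∞) (Upos : Set U) : Set X :=
  closure (⋃ t ∈ Ici (0 : ℝ), S.approxPosReachAt p Upos t)

end BoundaryControlSystem

/-! Write `S_λ(h) = exp (-λ h) T(h)`, whose generator is `A - λ`. A state `x` is reached by the
control `u` with input integral `I` exactly when `I ∈ D(A)` and `(λ - A) I = x`, so `x = lim h⁻¹ (I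
- S_λ(h) I)` as `h ↓ 0`. Taking the difference under the integral makes the integrand `T(t - s) B_λ
u(s) - S_λ(h) T(t - s) B_λ u(s)`, which for each `s` is itself a state produced by a pulse `exp (λ
s) v` on an interval. Integrals of cone-valued functions stay in a closed convex cone, so `x` lies
in the cone of pulses (`exactPosReach_subset`). No approximation of controls by step functions is
involved, and `p = ∞` needs no separate treatment. Conversely pulses are reachable, at every
sufficiently late time, and this gives the first representation (`approxPosReach_eq`).

The orbit representation compares pulses with the states `B_λ v`. Letting the pulse length tend to
infinity gives `B_λ v` as the limit of `B_λ v - S_λ(t) B_λ v`. In the other direction, with `y = B_λ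
v`, the identity `B_{λ+μ} v = y - μ R(λ+μ) y` gives `R(λ+μ) (y - S_λ(h) y) = ∫₀ʰ S_λ(s) B_{λ+μ} v
ds`, and `μ R(λ+μ) → 1` strongly as `μ → ∞` (`sub_expShift_mem`).

For the resolvent representation it remains to see that the cone generated by the `R(λ)ⁿ B_λ v` is
invariant under the semigroup. The part with one fixed `λ` is invariant under `R(λ)`, hence under
`R(μ)` for `w < μ ≤ λ` by a Neumann series with nonnegative coefficients, and it contains `B_μ v`
for these `μ`. Passing to the larger of two parameters makes the whole cone resolvent invariant, and
Euler's formula then yields invariance under `T(t)` (`semigroup_mem`). -/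

set_option linter.unusedSectionVars false

/-! ### Strongly continuous semigroups: bounds and continuity -/

section SemigroupTheory

variable {𝕜 X : Type*} [RCLike 𝕜] [NormedAddCommGroup X] [NormedSpace 𝕜 X]

namespace IsC0Semigroup

variable {T : ℝ → X →L[𝕜] X}

theorem exists_bound_Icc [CompleteSpace X] (hT : IsC0Semigroup T) (b : ℝ) :
    ∃ M : ℝ, ∀ s ∈ Icc 0 b, ‖T s‖ ≤ M := by
  obtain ⟨M, hM⟩ := banach_steinhaus (g := fun s : Icc (0 : ℝ) b => T s) (fun x => by
    obtain ⟨C, hC⟩ := isCompact_Icc.exists_bound_of_continuousOn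
      ((hT.strongly_continuous x).mono fun _ hs => hs.1)
    exact ⟨C, fun s => hC s s.2⟩)
  exact ⟨M, fun s hs => hM ⟨s, hs⟩⟩

theorem exists_exponential_bound [CompleteSpace X] (hT : IsC0Semigroup T) :
    ∃ M w : ℝ, ∀ t : ℝ, 0 ≤ t → ‖T t‖ ≤ M * Real.exp (w * t) := by
  obtain ⟨M₀, hM₀⟩ := hT.exists_bound_Icc 1
  set M := max M₀ 1
  have hM : ∀ s ∈ Icc (0 : ℝ) 1, ‖T s‖ ≤ M := fun s hs => (hM₀ s hs).trans (le_max_left _ _)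
  have hM1 : 1 ≤ M := le_max_right _ _
  have key : ∀ n : ℕ, ∀ r ∈ Icc (0 : ℝ) 1, ‖T (n + r)‖ ≤ M * M ^ n := by
    intro n
    induction n with
    | zero => intro r hr; simpa using hM r hr
    | succ n ih =>
      intro r hr
      have h1 : ((n + 1 : ℕ) : ℝ) + r = 1 + (n + r) := by push_cast; ring
      rw [h1, hT.map_add 1 (n + r) zero_le_one (add_nonneg n.cast_nonneg hr.1)]
      refine (ContinuousLinearMap.opNorm_comp_le _ _).trans ?_
      calc ‖T 1‖ * ‖T (n + r)‖ ≤ M * (M * M ^ n) := by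
            gcongr
            · exact hM 1 ⟨zero_le_one, le_rfl⟩
            · exact ih r hr
        _ = M * M ^ (n + 1) := by ring
  -- `M ^ ⌊t⌋ = exp (⌊t⌋ log M) ≤ exp (t log M)`; enlarging `M` to at least `1` makes `log M`
  -- nonnegative.
  refine ⟨M, Real.log M, fun t ht => ?_⟩
  have h1 := key ⌊t⌋₊ (t - ⌊t⌋₊) ⟨sub_nonneg.2 (Nat.floor_le ht), by
    linarith [Nat.lt_floor_add_one t]⟩
  rw [add_sub_cancel] at h1
  refine h1.trans (mul_le_mul_of_nonneg_left ?_ (zero_le_one.trans hM1))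
  rw [← Real.rpow_natCast, Real.rpow_def_of_pos (zero_lt_one.trans_le hM1)]
  exact Real.exp_le_exp.2 (mul_le_mul_of_nonneg_left (Nat.floor_le ht) (Real.log_nonneg hM1))

/-- Strong continuity and the local norm bound give joint continuity. The truncation `max · 0`
discards the arbitrary values at negative times, so that composition with measurable functions on
all of `ℝ` is available. -/
theorem continuous_apply_max [CompleteSpace X] (hT : IsC0Semigroup T) :
    Continuous (fun q : ℝ × X => T (max q.1 0) q.2) := by
  rw [continuous_iff_continuousAt]
  rintro ⟨r, x⟩
  obtain ⟨M, hM⟩ := hT.exists_bound_Icc (max r 0 + 1)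
  have hc : Continuous (fun s : ℝ => T (max s 0) x) :=
    (hT.strongly_continuous x).comp_continuous (by fun_prop) (fun s => mem_Ici.2 (le_max_right _ _))
  have h1 : Tendsto (fun q : ℝ × X => T (max q.1 0) (q.2 - x)) (𝓝 (r, x)) (𝓝 0) := by
    have h2 : Tendsto (fun q : ℝ × X => M * ‖q.2 - x‖) (𝓝 (r, x)) (𝓝 0) := by
      have : Continuous (fun q : ℝ × X => M * ‖q.2 - x‖) := by fun_prop
      simpa using this.tendsto (r, x)
    refine squeeze_zero_norm' ?_ h2
    have h3 : ∀ᶠ q : ℝ × X in 𝓝 (r, x), max q.1 0 < max r 0 + 1 := by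
      have : Continuous (fun q : ℝ × X => max q.1 0) := by fun_prop
      exact this.tendsto (r, x) (Iio_mem_nhds (by simp))
    filter_upwards [h3] with q hq
    exact (ContinuousLinearMap.le_opNorm _ _).trans
      (mul_le_mul_of_nonneg_right (hM _ ⟨le_max_right _ _, hq.le⟩) (norm_nonneg _))
  have h2 : Tendsto (fun q : ℝ × X => T (max q.1 0) x) (𝓝 (r, x)) (𝓝 (T (max r 0) x)) :=
    (hc.comp continuous_fst).tendsto (r, x)
  have h3 := h1.add h2
  rw [zero_add] at h3
  refine h3.congr fun q => ?_
  rw [map_sub, sub_add_cancel]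

theorem continuous_orbit [CompleteSpace X] (hT : IsC0Semigroup T) (x : X) :
    Continuous (fun s : ℝ => T (max s 0) x) :=
  hT.continuous_apply_max.comp (continuous_id.prodMk continuous_const)

theorem continuousOn_orbit [CompleteSpace X] (hT : IsC0Semigroup T) (x : X) {a b : ℝ}
    (ha : 0 ≤ a) (hb : 0 ≤ b) : ContinuousOn (fun s : ℝ => T s x) (uIcc a b) :=
  (hT.strongly_continuous x).mono fun _ hs => (le_min ha hb).trans hs.1

theorem intervalIntegrable_orbit [CompleteSpace X] (hT : IsC0Semigroup T) (x : X) {a b : ℝ}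
    (ha : 0 ≤ a) (hb : 0 ≤ b) : IntervalIntegrable (fun s : ℝ => T s x) volume a b :=
  (hT.continuousOn_orbit x ha hb).intervalIntegrable

theorem commute (hT : IsC0Semigroup T) {s t : ℝ} (hs : 0 ≤ s) (ht : 0 ≤ t) (x : X) :
    T s (T t x) = T t (T s x) := by
  have h1 := hT.map_add s t hs ht
  rw [add_comm, hT.map_add t s ht hs] at h1
  exact (congrArg (fun f : X →L[𝕜] X => f x) h1).symm

theorem map_add_apply (hT : IsC0Semigroup T) {s t : ℝ} (hs : 0 ≤ s) (ht : 0 ≤ t) (x : X) :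
    T (s + t) x = T s (T t x) := by
  rw [hT.map_add s t hs ht]; rfl

theorem map_zero_apply (hT : IsC0Semigroup T) (x : X) : T 0 x = x := by
  rw [hT.map_zero]; rfl

/-- A semigroup applied to an integrable inhomogeneity is integrable. -/
theorem integrable_convolution [CompleteSpace X] (hT : IsC0Semigroup T) {t : ℝ}
    {f : ℝ → X} (hf : Integrable f (volume.restrict (Icc 0 t))) :
    Integrable (fun s => T (t - s) (f s)) (volume.restrict (Icc 0 t)) := by
  obtain ⟨M, hM⟩ := hT.exists_bound_Icc t
  have hmem : ∀ᵐ s ∂(volume.restrict (Icc 0 t)), s ∈ Icc 0 t :=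
    ae_restrict_mem measurableSet_Icc
  have hmeas : AEStronglyMeasurable (fun s => T (max (t - s) 0) (f s))
      (volume.restrict (Icc 0 t)) :=
    hT.continuous_apply_max.comp_aestronglyMeasurable
      ((by fun_prop : Continuous fun s : ℝ => t - s).aestronglyMeasurable.prodMk
        hf.aestronglyMeasurable)
  have hmeas' := hmeas.congr (g := fun s => T (t - s) (f s)) (by
    filter_upwards [hmem] with s hs
    rw [max_eq_left (sub_nonneg.2 hs.2)])
  refine (hf.norm.const_mul M).mono' hmeas' ?_
  filter_upwards [hmem] with s hs
  exact (ContinuousLinearMap.le_opNorm _ _).trans (mul_le_mul_of_nonneg_right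
    (hM _ ⟨sub_nonneg.2 hs.2, by linarith [hs.1]⟩) (norm_nonneg _))

end IsC0Semigroup

/-! ### Difference quotients and orbit integrals -/

section GeneratorPairs

variable [NormedSpace ℝ X]

/-- The pair `(x, y)` belongs to the graph of the generator of `T`. -/
def IsGeneratorPair (T : ℝ → X →L[𝕜] X) (x y : X) : Prop :=
  Tendsto (fun h : ℝ => h⁻¹ • (T h x - x)) (𝓝[>] 0) (𝓝 y)

variable [IsScalarTower ℝ 𝕜 X] {T : ℝ → X →L[𝕜] X}

theorem IsGeneratorPair.map {x y : X} (h : IsGeneratorPair T x y) (L : X →L[𝕜] X)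
    (hL : ∀ t : ℝ, 0 ≤ t → ∀ z, L (T t z) = T t (L z)) : IsGeneratorPair T (L x) (L y) := by
  refine ((L.continuous.tendsto y).comp h).congr' ?_
  filter_upwards [self_mem_nhdsWithin] with r hr
  simp only [Function.comp_apply, L.map_smul_of_tower, map_sub, hL r (le_of_lt hr)]

theorem tendsto_inv_smul_integral_of_continuous [CompleteSpace X] {f : ℝ → X} (hf : Continuous f)
    (a : ℝ) :
    Tendsto (fun h : ℝ => h⁻¹ • ∫ s in a..(a + h), f s) (𝓝[>] 0) (𝓝 (f a)) := by
  have h1 : HasDerivAt (fun r => ∫ s in a..r, f s) (f a) a :=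
    intervalIntegral.integral_hasDerivAt_right (hf.intervalIntegrable _ _)
      (hf.stronglyMeasurableAtFilter _ _) hf.continuousAt
  have h2 := hasDerivAt_iff_tendsto_slope_zero.1 h1
  refine (h2.mono_left (nhdsWithin_mono 0 fun x hx => ne_of_gt hx)).congr fun h => ?_
  simp

namespace IsC0Semigroup

variable [CompleteSpace X]

theorem tendsto_inv_smul_integral (hT : IsC0Semigroup T) (x : X) {a : ℝ} (ha : 0 ≤ a) :
    Tendsto (fun h : ℝ => h⁻¹ • ∫ s in a..(a + h), T s x) (𝓝[>] 0) (𝓝 (T a x)) := by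
  have h1 := tendsto_inv_smul_integral_of_continuous (hT.continuous_orbit x) a
  rw [max_eq_left ha] at h1
  refine h1.congr' ?_
  filter_upwards [self_mem_nhdsWithin] with h (hh : 0 < h)
  congr 1
  refine intervalIntegral.integral_congr fun s hs => ?_
  rw [uIcc_of_le (by linarith)] at hs
  rw [max_eq_left (ha.trans hs.1)]

theorem map_integral_orbit (hT : IsC0Semigroup T) (x : X) {a b h : ℝ}
    (ha : 0 ≤ a) (hb : 0 ≤ b) (hh : 0 ≤ h) :
    T h (∫ s in a..b, T s x) = ∫ s in (a + h)..(b + h), T s x := by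
  rw [← ContinuousLinearMap.intervalIntegral_comp_comm _ (hT.intervalIntegrable_orbit x ha hb),
    ← intervalIntegral.integral_comp_add_right]
  refine intervalIntegral.integral_congr fun s hs => ?_
  have hs0 : 0 ≤ s := (le_min ha hb).trans hs.1
  rw [add_comm, hT.map_add_apply hh hs0]

/-- `T h` shifts the interval of integration by `h`, so the difference quotient is the mean over
`[b, b + h]` minus the mean over `[a, a + h]`. -/
theorem isGeneratorPair_integral (hT : IsC0Semigroup T) (x : X) {a b : ℝ}
    (ha : 0 ≤ a) (hb : 0 ≤ b) :
    IsGeneratorPair T (∫ s in a..b, T s x) (T b x - T a x) := by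
  refine ((hT.tendsto_inv_smul_integral x hb).sub (hT.tendsto_inv_smul_integral x ha)).congr' ?_
  filter_upwards [self_mem_nhdsWithin] with h (hh : 0 < h)
  have hI : ∀ {c d : ℝ}, 0 ≤ c → 0 ≤ d → IntervalIntegrable (fun s => T s x) volume c d :=
    fun hc hd => hT.intervalIntegrable_orbit x hc hd
  have hah : 0 ≤ a + h := by linarith
  have hbh : 0 ≤ b + h := by linarith
  rw [hT.map_integral_orbit x ha hb hh.le, ← smul_sub]
  congr 1
  rw [← intervalIntegral.integral_add_adjacent_intervals (hI hah hb) (hI hb hbh),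
    ← intervalIntegral.integral_add_adjacent_intervals (hI ha hah) (hI hah hb)]
  abel

/-- The definition of the generator supplies only a right derivative of the orbit; this suffices
because the orbit is continuous and the derivative integrable. -/
theorem sub_eq_integral (hT : IsC0Semigroup T) {x y : X} (h : IsGeneratorPair T x y) {t : ℝ}
    (ht : 0 ≤ t) : T t x - x = ∫ s in (0 : ℝ)..t, T s y := by
  have h1 := intervalIntegral.integral_eq_sub_of_hasDeriv_right (f := fun s => T s x)
    (f' := fun s => T s y) (hT.continuousOn_orbit x le_rfl ht) ?_
    (hT.intervalIntegrable_orbit y le_rfl ht)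
  · rw [h1]; simp only [hT.map_zero_apply]
  · intro s hs
    rw [min_eq_left ht] at hs
    have h2 : IsGeneratorPair T (T s x) (T s y) :=
      h.map (T s) fun r hr z => hT.commute hs.1.le hr z
    rw [hasDerivWithinAt_iff_tendsto_slope' (by simp)]
    have h3 : Tendsto (fun r : ℝ => r - s) (𝓝[>] s) (𝓝[>] 0) := by
      refine tendsto_nhdsWithin_of_tendsto_nhds_of_eventually_within _ ?_ ?_
      · have : Continuous fun r : ℝ => r - s := by fun_prop
        simpa using (this.tendsto s).mono_left nhdsWithin_le_nhds
      · filter_upwards [self_mem_nhdsWithin] with r hr using sub_pos.2 (mem_Ioi.1 hr)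
    refine (h2.comp h3).congr' ?_
    filter_upwards [self_mem_nhdsWithin] with r (hr : s < r)
    simp only [Function.comp_apply, slope, vsub_eq_sub]
    rw [← hT.map_add_apply (by linarith) hs.1.le, sub_add_cancel]

end IsC0Semigroup

end GeneratorPairs

end SemigroupTheory

/-! ### Closed convex cones and integration -/

section ClosedCones

variable {E F : Type*} [NormedAddCommGroup E] [NormedSpace ℝ E]
  [NormedAddCommGroup F] [NormedSpace ℝ F]

/-- Closed convex cones (containing `0`). -/
structure IsClosedConvexCone (C : Set E) : Prop where
  isClosed : IsClosed C
  convex : Convex ℝ C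
  zero_mem : (0 : E) ∈ C
  smul_mem : ∀ c : ℝ, 0 ≤ c → ∀ x ∈ C, c • x ∈ C

namespace IsClosedConvexCone

variable {C : Set E}

theorem add_mem (hC : IsClosedConvexCone C) {x y : E} (hx : x ∈ C) (hy : y ∈ C) : x + y ∈ C := by
  have h1 := hC.smul_mem 2 zero_le_two _
    (hC.convex hx hy (a := 2⁻¹) (b := 2⁻¹) (by norm_num) (by norm_num) (by norm_num))
  rwa [← smul_add, smul_smul, mul_inv_cancel₀ two_ne_zero, one_smul] at h1

theorem sum_mem (hC : IsClosedConvexCone C) {ι : Type*} (s : Finset ι) {f : ι → E}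
    (hf : ∀ i ∈ s, f i ∈ C) : ∑ i ∈ s, f i ∈ C := by
  classical
  induction s using Finset.induction_on with
  | empty => simpa using hC.zero_mem
  | insert a s ha ih =>
    rw [Finset.sum_insert ha]
    exact hC.add_mem (hf a (Finset.mem_insert_self a s))
      (ih fun i hi => hf i (Finset.mem_insert_of_mem hi))

/-- The average of `f` lies in the closed convex set `C`, and the integral is a nonnegative multiple
of it. -/
theorem setIntegral_mem [CompleteSpace E] (hC : IsClosedConvexCone C) {s : Set ℝ} {f : ℝ → E}
    (hs : volume s ≠ ∞) (hf : ∀ᵐ r ∂(volume.restrict s), f r ∈ C)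
    (hfi : IntegrableOn f s) : ∫ r in s, f r ∈ C := by
  by_cases h0 : volume s = 0
  · rw [Measure.restrict_eq_zero.2 h0, integral_zero_measure]
    exact hC.zero_mem
  · have h1 := hC.smul_mem (volume.real s) measureReal_nonneg _
      (hC.convex.set_average_mem hC.isClosed h0 hs hf hfi)
    have : IsFiniteMeasure (volume.restrict s) := ⟨by simpa using hs.lt_top⟩
    rwa [setAverage_eq, smul_smul, mul_inv_cancel₀, one_smul] at h1
    rw [measureReal_def]
    exact (ENNReal.toReal_pos h0 hs).ne'

theorem intervalIntegral_mem [CompleteSpace E] (hC : IsClosedConvexCone C) {a b : ℝ} (hab : a ≤ b)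
    {f : ℝ → E} (hf : ∀ r ∈ Ioc a b, f r ∈ C) (hfi : IntervalIntegrable f volume a b) :
    ∫ r in a..b, f r ∈ C := by
  rw [intervalIntegral.integral_of_le hab]
  exact hC.setIntegral_mem measure_Ioc_lt_top.ne (ae_restrict_of_forall_mem measurableSet_Ioc hf)
    hfi.1

end IsClosedConvexCone

theorem isClosedConvexCone_closedConvexHull {s : Set E} (h0 : (0 : E) ∈ s)
    (hs : ∀ c : ℝ, 0 ≤ c → ∀ x ∈ s, c • x ∈ s) : IsClosedConvexCone (closedConvexHull ℝ s) where
  isClosed := isClosed_closedConvexHull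
  convex := convex_closedConvexHull
  zero_mem := subset_closedConvexHull h0
  smul_mem := fun c hc => by
    have h1 : closedConvexHull ℝ s ⊆ (fun x : E => c • x) ⁻¹' closedConvexHull ℝ s :=
      closedConvexHull_min (fun x hx => subset_closedConvexHull (hs c hc x hx))
        (convex_closedConvexHull.is_linear_preimage
          ⟨fun x y => smul_add c x y, fun r x => smul_comm c r x⟩)
        (isClosed_closedConvexHull.preimage (continuous_const_smul c))
    exact fun x hx => h1 hx

/-- A continuous linear map sends a closed convex hull into a closed convex set as soon as it does
so with the generating set. -/
theorem mapsTo_closedConvexHull (L : E →L[ℝ] F) {s : Set E} {C : Set F} (hconv : Convex ℝ C)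
    (hcl : IsClosed C) (h : ∀ x ∈ s, L x ∈ C) {x : E} (hx : x ∈ closedConvexHull ℝ s) : L x ∈ C :=
  (closedConvexHull_min (t := L ⁻¹' C) h (hconv.linear_preimage L.toLinearMap)
    (hcl.preimage L.continuous)) hx

end ClosedCones

/-! ### Rescaled semigroups, Laplace transform and Hille-Yosida estimates -/

section Resolvents

variable {𝕜 X : Type*} [RCLike 𝕜] [NormedAddCommGroup X] [NormedSpace 𝕜 X] [NormedSpace ℝ X]
  [IsScalarTower ℝ 𝕜 X] {T : ℝ → X →L[𝕜] X} {A : X →ₗ.[𝕜] X}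

theorem IsGeneratorPair.smul {x y : X} (h : IsGeneratorPair T x y) (c : ℝ) :
    IsGeneratorPair T (c • x) (c • y) := by
  refine (Tendsto.const_smul h c).congr fun r => ?_
  rw [(T r).map_smul_of_tower, ← smul_sub, smul_comm]

/-- The rescaled semigroup `exp (-lam t) T t`. -/
noncomputable def expShift (lam : ℝ) (T : ℝ → X →L[𝕜] X) (t : ℝ) : X →L[𝕜] X :=
  Real.exp (-(lam * t)) • T t

theorem expShift_apply (lam t : ℝ) (x : X) :
    expShift lam T t x = Real.exp (-(lam * t)) • T t x := rfl

theorem exp_smul_expShift_apply (lam t : ℝ) (x : X) :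
    Real.exp (lam * t) • expShift lam T t x = T t x := by
  rw [expShift_apply, smul_smul, ← Real.exp_add, add_neg_cancel, Real.exp_zero, one_smul]

theorem isC0Semigroup_expShift (hT : IsC0Semigroup T) (lam : ℝ) :
    IsC0Semigroup (expShift lam T) where
  map_zero := by simp [expShift, hT.map_zero]
  map_add := fun s t hs ht => by
    ext x
    simp only [expShift_apply, ContinuousLinearMap.comp_apply, hT.map_add_apply hs ht,
      ContinuousLinearMap.map_smul_of_tower, smul_smul, ← Real.exp_add]
    congr 2
    ring
  strongly_continuous := fun x => by
    have := hT.strongly_continuous x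
    simp only [expShift_apply]
    exact ContinuousOn.smul (by fun_prop) this

theorem expShift_neg_expShift (lam : ℝ) : expShift (-lam) (expShift lam T) = T := by
  funext t
  ext x
  rw [expShift_apply, neg_mul, neg_neg, exp_smul_expShift_apply]

/-- Product rule at `0` for the scalar exponential times the orbit. -/
theorem IsGeneratorPair.expShift {x y : X} (h : IsGeneratorPair T x y) (lam : ℝ) :
    IsGeneratorPair (expShift lam T) x (y - lam • x) := by
  have h1 : HasDerivAt (fun r : ℝ => Real.exp (-(lam * r))) (-lam) 0 := by
    simpa using ((hasDerivAt_id (0 : ℝ)).const_mul (-lam)).exp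
  have h2 := (hasDerivAt_iff_tendsto_slope_zero.1 h1).mono_left
    (nhdsWithin_mono (0 : ℝ) (t := {0}ᶜ) fun x (hx : x ∈ Ioi 0) => ne_of_gt hx)
  have h3 : Tendsto (fun r : ℝ => Real.exp (-(lam * r))) (𝓝[>] 0) (𝓝 1) := by
    simpa using h1.continuousAt.tendsto.mono_left (nhdsWithin_le_nhds (s := Ioi 0))
  have h4 := (h3.smul h).add (h2.smul_const x)
  rw [one_smul, neg_smul, ← sub_eq_add_neg] at h4
  refine h4.congr fun r => ?_
  simp only [expShift_apply, zero_add, mul_zero, neg_zero, Real.exp_zero, smul_eq_mul]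
  module

theorem isGeneratorPair_expShift_iff (lam : ℝ) {x y : X} :
    IsGeneratorPair (expShift lam T) x (y - lam • x) ↔ IsGeneratorPair T x y := by
  refine ⟨fun h => ?_, fun h => h.expShift lam⟩
  have := h.expShift (-lam)
  rwa [expShift_neg_expShift, neg_smul, sub_neg_eq_add, sub_add_cancel] at this

theorem isResolventAt_unique {lam : 𝕜} {R R' : X →L[𝕜] X} (h : IsResolventAt A lam R)
    (h' : IsResolventAt A lam R') : R = R' := by
  ext x
  obtain ⟨y, hy1, hy2⟩ := LinearPMap.mem_graph_iff _ |>.1 (h.1 x)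
  dsimp only at hy1 hy2
  have := h'.2 y
  rw [hy1, hy2, sub_sub_cancel] at this
  exact this.symm

theorem resolventOp_eq {lam : 𝕜} {R : X →L[𝕜] X} (h : IsResolventAt A lam R) :
    resolventOp A lam = R :=
  isResolventAt_unique (resolventOp_spec ⟨R, h⟩) h

theorem IsResolventAt.apply_eq {lam : 𝕜} {R : X →L[𝕜] X} (h : IsResolventAt A lam R) {x y : X}
    (hxy : (x, y) ∈ A.graph) : R (lam • x - y) = x := by
  obtain ⟨z, hz1, hz2⟩ := LinearPMap.mem_graph_iff _ |>.1 hxy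
  dsimp only at hz1 hz2
  rw [← hz1, ← hz2]
  exact h.2 z

theorem resolventOp_apply_eq {lam : 𝕜} (h : lam ∈ resolventSetOf A) {x y : X}
    (hxy : (x, y) ∈ A.graph) : resolventOp A lam (lam • x - y) = x :=
  (resolventOp_spec h).apply_eq hxy

/-- The resolvent identity. -/
theorem resolventOp_identity {lam mu : 𝕜} (hl : lam ∈ resolventSetOf A)
    (hm : mu ∈ resolventSetOf A) (x : X) :
    resolventOp A mu x =
      resolventOp A lam x + (lam - mu) • resolventOp A lam (resolventOp A mu x) := by
  have h1 := resolventOp_apply_eq hl ((resolventOp_spec hm).1 x)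
  rw [← map_smul, ← map_add, ← h1]
  congr 1
  rw [h1, sub_smul]
  abel

/-- Obtained by writing `x = R((λ + μ) x - y)`. The right side is `O(1/μ)`, which makes `μ R(λ+μ)`
an approximate identity on the domain. -/
theorem smul_resolventOp_sub {lam mu : ℝ} (hl : ((lam + mu : ℝ) : 𝕜) ∈ resolventSetOf A) {x y : X}
    (hxy : (x, y) ∈ A.graph) :
    mu • resolventOp A ((lam + mu : ℝ) : 𝕜) x - x =
      resolventOp A ((lam + mu : ℝ) : 𝕜) (y - lam • x) := by
  nth_rewrite 2 [← resolventOp_apply_eq hl hxy]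
  rw [← ContinuousLinearMap.map_smul_of_tower, ← map_sub, ← RCLike.real_smul_eq_coe_smul, add_smul]
  congr 1
  abel

variable [CompleteSpace X] {M w : ℝ}

theorem norm_expShift_apply_le (hb : ∀ t : ℝ, 0 ≤ t → ‖T t‖ ≤ M * Real.exp (w * t)) (lam : ℝ)
    {t : ℝ} (ht : 0 ≤ t) (x : X) :
    ‖expShift lam T t x‖ ≤ M * ‖x‖ * Real.exp ((w - lam) * t) := by
  rw [expShift_apply, norm_smul, Real.norm_eq_abs, Real.abs_exp]
  calc Real.exp (-(lam * t)) * ‖T t x‖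
      ≤ Real.exp (-(lam * t)) * (M * Real.exp (w * t) * ‖x‖) := by
        gcongr
        exact (T t).le_of_opNorm_le (hb t ht) x
    _ = M * ‖x‖ * Real.exp ((w - lam) * t) := by
        rw [sub_mul, sub_eq_add_neg, Real.exp_add]; ring

theorem tendsto_expShift_zero (hb : ∀ t : ℝ, 0 ≤ t → ‖T t‖ ≤ M * Real.exp (w * t)) {lam : ℝ}
    (hlam : w < lam) (x : X) : Tendsto (fun t => expShift lam T t x) atTop (𝓝 0) := by
  have h1 : Tendsto (fun t : ℝ => M * ‖x‖ * Real.exp ((w - lam) * t)) atTop (𝓝 0) := by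
    have := (Real.tendsto_exp_atBot.comp
      (tendsto_id.const_mul_atTop_of_neg (sub_neg.2 hlam))).const_mul (M * ‖x‖)
    simpa using this
  refine squeeze_zero_norm' ?_ h1
  filter_upwards [eventually_ge_atTop 0] with t ht using norm_expShift_apply_le hb lam ht x

theorem integrableOn_expShift (hT : IsC0Semigroup T)
    (hb : ∀ t : ℝ, 0 ≤ t → ‖T t‖ ≤ M * Real.exp (w * t)) {lam : ℝ} (hlam : w < lam) (x : X) :
    IntegrableOn (fun s => expShift lam T s x) (Ioi 0) := by
  refine ((integrableOn_exp_mul_Ioi (sub_neg.2 hlam) 0).const_mul (M * ‖x‖)).mono' ?_ ?_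
  · exact (((isC0Semigroup_expShift hT lam).strongly_continuous x).mono
      Ioi_subset_Ici_self).aestronglyMeasurable measurableSet_Ioi
  · exact ae_restrict_of_forall_mem measurableSet_Ioi fun t ht =>
      norm_expShift_apply_le hb lam (le_of_lt ht) x

/-- The resolvent is the Laplace transform of the semigroup. -/
theorem exists_isResolventAt (hT : IsC0Semigroup T) (hA : IsGenerator A T)
    (hb : ∀ t : ℝ, 0 ≤ t → ‖T t‖ ≤ M * Real.exp (w * t)) {lam : ℝ} (hlam : w < lam) :
    ∃ R : X →L[𝕜] X, IsResolventAt A (lam : 𝕜) R ∧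
      ∀ x, R x = ∫ s in Ioi (0 : ℝ), expShift lam T s x := by
  have hS := isC0Semigroup_expShift hT lam
  have hint := fun x => integrableOn_expShift hT hb hlam x
  let R₀ : X →ₗ[𝕜] X :=
    { toFun := fun x => ∫ s in Ioi (0 : ℝ), expShift lam T s x
      map_add' := fun x y => by
        simp only [map_add]
        exact integral_add (hint x) (hint y)
      map_smul' := fun c x => by
        simp only [map_smul, RingHom.id_apply]
        exact integral_smul c _ }
  let R : X →L[𝕜] X := R₀.mkContinuous (M * ∫ s in Ioi (0 : ℝ), Real.exp ((w - lam) * s))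
    (fun x => by
      have h1 : ‖∫ s in Ioi (0 : ℝ), expShift lam T s x‖ ≤
          ∫ s in Ioi (0 : ℝ), M * ‖x‖ * Real.exp ((w - lam) * s) :=
        norm_integral_le_of_norm_le ((integrableOn_exp_mul_Ioi (sub_neg.2 hlam) 0).const_mul _)
          (ae_restrict_of_forall_mem measurableSet_Ioi fun t ht =>
            norm_expShift_apply_le hb lam (le_of_lt ht) x)
      rw [integral_const_mul] at h1
      refine h1.trans (le_of_eq (by ring)))
  have hR : ∀ x, R x = ∫ s in Ioi (0 : ℝ), expShift lam T s x := fun x => rfl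
  refine ⟨R, ⟨fun x => ?_, fun y => ?_⟩, hR⟩
  -- Applying the rescaled semigroup at `h` turns the Laplace integral into the one over `(h, ∞)`;
  -- the quotient is minus the mean over `[0, h]`.
  · have h1 : IsGeneratorPair (expShift lam T) (R x) (-x) := by
      have h2 := (hS.tendsto_inv_smul_integral x le_rfl).neg
      rw [hS.map_zero_apply] at h2
      refine h2.congr' ?_
      filter_upwards [self_mem_nhdsWithin] with h (hh : 0 < h)
      have h3 : expShift lam T h (R x) = ∫ s in Ioi h, expShift lam T s x := by
        rw [hR, ← ContinuousLinearMap.integral_comp_comm _ (hint x)]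
        have h4 := (measurePreserving_add_right volume h).setIntegral_preimage_emb
          (measurableEmbedding_addRight h) (fun s => expShift lam T s x) (Ioi h)
        rw [← h4]
        have : (fun s : ℝ => s + h) ⁻¹' Ioi h = Ioi 0 := by ext; simp
        rw [this]
        refine setIntegral_congr_fun measurableSet_Ioi fun s hs => ?_
        rw [add_comm, hS.map_add_apply hh.le (le_of_lt hs)]
      rw [h3, hR, zero_add, ← intervalIntegral.integral_Ioi_sub_Ioi (hint x) hh.le, ← smul_neg,
        neg_sub]
    rw [hA, ← RCLike.real_smul_eq_coe_smul]
    refine (isGeneratorPair_expShift_iff lam).1 ?_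
    rwa [sub_sub_cancel_left]
  -- Left inverse: let `t → ∞` in `S(t) y - y = ∫₀ᵗ S(s) (A y - λ y) ds`, with `S` the rescaled
  -- semigroup.
  · have h1 : IsGeneratorPair T (y : X) (A y) := (hA _ _).1 (A.mem_graph y)
    have h2 := h1.expShift lam
    have h3 := intervalIntegral_tendsto_integral_Ioi 0 (hint (A y - lam • (y : X))) tendsto_id
    have h4 := (tendsto_expShift_zero hb hlam (y : X)).sub_const (y : X)
    have h5 := tendsto_nhds_unique (h4.congr' (by
      filter_upwards [eventually_ge_atTop 0] with t ht using hS.sub_eq_integral h2 ht)) h3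
    rw [← RCLike.real_smul_eq_coe_smul, ← neg_sub, map_neg, hR, ← h5, zero_sub, neg_neg]

theorem mem_resolventSetOf (hT : IsC0Semigroup T) (hA : IsGenerator A T)
    (hb : ∀ t : ℝ, 0 ≤ t → ‖T t‖ ≤ M * Real.exp (w * t)) {lam : ℝ} (hlam : w < lam) :
    (lam : 𝕜) ∈ resolventSetOf A :=
  let ⟨R, hR, _⟩ := exists_isResolventAt hT hA hb hlam
  ⟨R, hR⟩

theorem resolventOp_eq_integral (hT : IsC0Semigroup T) (hA : IsGenerator A T)
    (hb : ∀ t : ℝ, 0 ≤ t → ‖T t‖ ≤ M * Real.exp (w * t)) {lam : ℝ} (hlam : w < lam) (x : X) :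
    resolventOp A (lam : 𝕜) x = ∫ s in Ioi (0 : ℝ), expShift lam T s x := by
  obtain ⟨R, hR, h⟩ := exists_isResolventAt hT hA hb hlam
  rw [resolventOp_eq hR, h]

theorem resolventOp_mem (hT : IsC0Semigroup T) (hA : IsGenerator A T)
    (hb : ∀ t : ℝ, 0 ≤ t → ‖T t‖ ≤ M * Real.exp (w * t)) {lam : ℝ} (hlam : w < lam)
    {C : Set X} (hC : IsClosedConvexCone C) (hinv : ∀ t : ℝ, 0 ≤ t → ∀ x ∈ C, T t x ∈ C)
    {x : X} (hx : x ∈ C) : resolventOp A (lam : 𝕜) x ∈ C := by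
  rw [resolventOp_eq_integral hT hA hb hlam]
  refine hC.isClosed.mem_of_tendsto (intervalIntegral_tendsto_integral_Ioi 0
    (integrableOn_expShift hT hb hlam x) tendsto_id) ?_
  filter_upwards [eventually_ge_atTop 0] with t ht
  exact hC.intervalIntegral_mem ht
    (fun s hs => hC.smul_mem _ (Real.exp_pos _).le _ (hinv s hs.1.le x hx))
    ((isC0Semigroup_expShift hT lam).intervalIntegrable_orbit x le_rfl ht)

theorem resolventOp_commute (hT : IsC0Semigroup T) (hA : IsGenerator A T) {lam : 𝕜}
    (hl : lam ∈ resolventSetOf A) {t : ℝ} (ht : 0 ≤ t) (x : X) :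
    resolventOp A lam (T t x) = T t (resolventOp A lam x) := by
  have h1 : IsGeneratorPair T _ _ := (hA _ _).1 ((resolventOp_spec hl).1 x)
  have h2 := (hA _ _).2 (h1.map (T t) fun r hr z => hT.commute ht hr z)
  have h3 := resolventOp_apply_eq hl h2
  rwa [← map_smul (T t), ← map_sub (T t), sub_sub_cancel] at h3

/-- Controlling the whole orbit rather than a single norm lets the estimate be iterated: each
resolvent costs `1 / (λ - w)` and the constant `M` enters only once. -/
theorem norm_orbit_resolventOp_le (hT : IsC0Semigroup T) (hA : IsGenerator A T)
    (hb : ∀ t : ℝ, 0 ≤ t → ‖T t‖ ≤ M * Real.exp (w * t)) {lam : ℝ} (hlam : w < lam) {K : ℝ}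
    {x : X} (hx : ∀ t : ℝ, 0 ≤ t → ‖T t x‖ ≤ K * Real.exp (w * t)) {t : ℝ} (ht : 0 ≤ t) :
    ‖T t (resolventOp A (lam : 𝕜) x)‖ ≤ K / (lam - w) * Real.exp (w * t) := by
  rw [← resolventOp_commute hT hA (mem_resolventSetOf hT hA hb hlam) ht,
    resolventOp_eq_integral hT hA hb hlam]
  have h1 : ‖∫ s in Ioi (0 : ℝ), expShift lam T s (T t x)‖ ≤
      ∫ s in Ioi (0 : ℝ), K * Real.exp (w * t) * Real.exp ((w - lam) * s) := by
    refine norm_integral_le_of_norm_le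
      ((integrableOn_exp_mul_Ioi (sub_neg.2 hlam) 0).const_mul _)
      (ae_restrict_of_forall_mem measurableSet_Ioi fun s hs => ?_)
    have hs0 : 0 ≤ s := le_of_lt hs
    rw [expShift_apply, ← hT.map_add_apply hs0 ht, norm_smul, Real.norm_eq_abs, Real.abs_exp]
    refine (mul_le_mul_of_nonneg_left (hx (s + t) (by linarith)) (Real.exp_pos _).le).trans
      (le_of_eq ?_)
    rw [mul_left_comm, mul_assoc, ← Real.exp_add, ← Real.exp_add]
    congr 2
    ring
  rw [integral_const_mul, integral_exp_mul_Ioi (sub_neg.2 hlam)] at h1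
  refine h1.trans (le_of_eq ?_)
  have h2 : lam - w ≠ 0 := (sub_pos.2 hlam).ne'
  have h3 : w - lam ≠ 0 := (sub_neg.2 hlam).ne
  rw [mul_zero, Real.exp_zero, ← neg_sub lam w]
  field_simp

/-- The Hille-Yosida estimate for powers of the resolvent. -/
theorem norm_resolventOp_pow_le (hT : IsC0Semigroup T) (hA : IsGenerator A T)
    (hb : ∀ t : ℝ, 0 ≤ t → ‖T t‖ ≤ M * Real.exp (w * t)) {lam : ℝ} (hlam : w < lam) (n : ℕ)
    (x : X) : ‖(resolventOp A (lam : 𝕜) ^ n) x‖ ≤ M * ‖x‖ / (lam - w) ^ n := by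
  have h1 : ∀ t : ℝ, 0 ≤ t → ‖T t ((resolventOp A (lam : 𝕜) ^ n) x)‖ ≤
      M * ‖x‖ / (lam - w) ^ n * Real.exp (w * t) := by
    induction n with
    | zero =>
      intro t ht
      simpa [mul_right_comm] using (T t).le_of_opNorm_le (hb t ht) x
    | succ n ih =>
      intro t ht
      have := norm_orbit_resolventOp_le hT hA hb hlam ih ht
      rw [div_div, ← pow_succ] at this
      rwa [pow_succ']
  simpa [hT.map_zero_apply] using h1 0 le_rfl

end Resolvents

/-! ### Yosida approximation, Euler's formula and invariant cones -/

section Approximations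

variable {𝕜 X : Type*} [RCLike 𝕜] [NormedAddCommGroup X] [NormedSpace 𝕜 X] [NormedSpace ℝ X]
  [IsScalarTower ℝ 𝕜 X] [CompleteSpace X] {T : ℝ → X →L[𝕜] X} {A : X →ₗ.[𝕜] X} {M w : ℝ}

theorem dense_domain (hT : IsC0Semigroup T) (hA : IsGenerator A T) (x : X) :
    x ∈ closure (A.domain : Set X) := by
  have h1 := hT.tendsto_inv_smul_integral x le_rfl
  rw [hT.map_zero_apply] at h1
  refine mem_closure_of_tendsto h1 ?_
  filter_upwards [self_mem_nhdsWithin] with h (hh : 0 < h)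
  rw [zero_add]
  have h2 := (hA _ _).2 ((hT.isGeneratorPair_integral x le_rfl hh.le).smul h⁻¹)
  exact LinearPMap.mem_domain_of_mem_graph h2

theorem norm_smul_resolventOp_pow_le (hT : IsC0Semigroup T) (hA : IsGenerator A T)
    (hb : ∀ t : ℝ, 0 ≤ t → ‖T t‖ ≤ M * Real.exp (w * t)) {lam mu : ℝ} (hlam : w < lam)
    (hmu : 0 ≤ mu) (n : ℕ) (x : X) :
    ‖mu ^ n • (resolventOp A ((lam + mu : ℝ) : 𝕜) ^ n) x‖ ≤ M * ‖x‖ := by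
  have hw : w < lam + mu := by linarith
  have hM : 0 ≤ M := by simpa using (norm_nonneg _).trans (hb 0 le_rfl)
  rw [norm_smul, norm_pow, Real.norm_of_nonneg hmu]
  calc mu ^ n * ‖(resolventOp A ((lam + mu : ℝ) : 𝕜) ^ n) x‖
      ≤ (lam + mu - w) ^ n * (M * ‖x‖ / (lam + mu - w) ^ n) := by
        gcongr
        · linarith
        · exact norm_resolventOp_pow_le hT hA hb hw n x
    _ = M * ‖x‖ := mul_div_cancel₀ _ (pow_ne_zero _ (sub_pos.2 hw).ne')

theorem tendsto_smul_resolventOp (hT : IsC0Semigroup T) (hA : IsGenerator A T)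
    (hb : ∀ t : ℝ, 0 ≤ t → ‖T t‖ ≤ M * Real.exp (w * t)) {lam : ℝ} (hlam : w < lam) (z : X) :
    Tendsto (fun mu : ℝ => mu • resolventOp A ((lam + mu : ℝ) : 𝕜) z) atTop (𝓝 z) := by
  have hM : 0 ≤ M := by simpa using (norm_nonneg _).trans (hb 0 le_rfl)
  have hdom : ∀ x ∈ A.domain,
      Tendsto (fun mu : ℝ => mu • resolventOp A ((lam + mu : ℝ) : 𝕜) x) atTop (𝓝 x) := by
    intro x hx
    set y := A ⟨x, hx⟩ - lam • x with hy
    have h1 : Tendsto (fun mu : ℝ => mu⁻¹ * (M * ‖y‖)) atTop (𝓝 0) := by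
      simpa using tendsto_inv_atTop_zero.mul_const (M * ‖y‖)
    rw [tendsto_iff_norm_sub_tendsto_zero]
    refine squeeze_zero' (Eventually.of_forall fun _ => norm_nonneg _) ?_ h1
    filter_upwards [eventually_gt_atTop 0] with mu hmu
    have hlm : w < lam + mu := by linarith
    have h2 := smul_resolventOp_sub (mem_resolventSetOf hT hA hb hlm) (A.mem_graph ⟨x, hx⟩)
    have h3 := norm_smul_resolventOp_pow_le hT hA hb hlam hmu.le 1 y
    rw [pow_one, pow_one, norm_smul, Real.norm_of_nonneg hmu.le] at h3
    rw [h2, ← hy]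
    rwa [← div_eq_inv_mul, le_div_iff₀' hmu]
  -- Extension from the dense domain: the three error terms are at most `M`, `1` and `1` times `ε /
  -- (M + 2)`.
  rw [Metric.tendsto_nhds]
  intro ε hε
  have hM2 : 0 < M + 2 := by linarith
  obtain ⟨x, hx, hxz⟩ := Metric.mem_closure_iff.1 (dense_domain hT hA z) (ε / (M + 2))
    (div_pos hε hM2)
  filter_upwards [Metric.tendsto_nhds.1 (hdom x hx) (ε / (M + 2)) (div_pos hε hM2),
    eventually_ge_atTop 0] with mu h1 hmu
  have h2 := norm_smul_resolventOp_pow_le hT hA hb hlam hmu 1 (z - x)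
  rw [pow_one, pow_one, map_sub, smul_sub, ← dist_eq_norm, ← dist_eq_norm] at h2
  have h3 := mul_le_mul_of_nonneg_left hxz.le hM
  calc dist (mu • resolventOp A ((lam + mu : ℝ) : 𝕜) z) z
      ≤ dist (mu • resolventOp A ((lam + mu : ℝ) : 𝕜) z)
          (mu • resolventOp A ((lam + mu : ℝ) : 𝕜) x) +
        dist (mu • resolventOp A ((lam + mu : ℝ) : 𝕜) x) x + dist x z := dist_triangle4 _ _ _ _
    _ < M * (ε / (M + 2)) + ε / (M + 2) + ε / (M + 2) := by
        rw [dist_comm x z]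
        linarith
    _ = ε := by field_simp; ring

/-- Euler's exponential formula on the domain of the generator. -/
theorem tendsto_euler (hT : IsC0Semigroup T) (hA : IsGenerator A T)
    (hb : ∀ t : ℝ, 0 ≤ t → ‖T t‖ ≤ M * Real.exp (w * t)) {lam : ℝ} (hlam : w < lam) {x y : X}
    (hxy : (x, y) ∈ A.graph) {t : ℝ} (ht : 0 < t) :
    Tendsto (fun n : ℕ => (n / t : ℝ) ^ n • (resolventOp A ((lam + n / t : ℝ) : 𝕜) ^ n) x) atTop
      (𝓝 (expShift lam T t x)) := by
  have hM : 0 ≤ M := by simpa using (norm_nonneg _).trans (hb 0 le_rfl)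
  have hS := isC0Semigroup_expShift hT lam
  set S := expShift lam T with hSdef
  set G : ℝ → X →L[𝕜] X := fun h => h⁻¹ • resolventOp A ((lam + h⁻¹ : ℝ) : 𝕜) with hG
  have hGpow : ∀ (h : ℝ) (n : ℕ) (z : X),
      (G h ^ n) z = h⁻¹ ^ n • (resolventOp A ((lam + h⁻¹ : ℝ) : 𝕜) ^ n) z := by
    intro h n z
    rw [hG, smul_pow]; rfl
  have hGb : ∀ h : ℝ, 0 < h → ∀ (n : ℕ) (z : X), ‖(G h ^ n) z‖ ≤ M * ‖z‖ := by
    intro h hh n z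
    rw [hGpow]
    exact norm_smul_resolventOp_pow_le hT hA hb hlam (inv_pos.2 hh).le n z
  have hSb : ∀ r : ℝ, 0 ≤ r → ∀ z : X, ‖S r z‖ ≤ M * ‖z‖ := by
    intro r hr z
    refine (norm_expShift_apply_le hb lam hr z).trans (mul_le_of_le_one_right (by positivity) ?_)
    exact Real.exp_le_one_iff.2 (mul_nonpos_of_nonpos_of_nonneg (sub_neg.2 hlam).le hr)
  have hl : ∀ h : ℝ, 0 < h → ((lam + h⁻¹ : ℝ) : 𝕜) ∈ resolventSetOf A := fun h hh =>
    mem_resolventSetOf hT hA hb (by linarith [inv_pos.2 hh])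
  have hcomm : ∀ h : ℝ, 0 < h → ∀ r : ℝ, 0 ≤ r → ∀ z, G h (S r z) = S r (G h z) := by
    intro h hh r hr z
    simp only [hG, hSdef, _root_.smul_apply, expShift_apply,
      ContinuousLinearMap.map_smul_of_tower, resolventOp_commute hT hA (hl h hh) hr]
  -- Telescoping of `S(nh) - G(h)ⁿ`. The surplus power `k` absorbs the factor `G h` left over by
  -- each step: all powers of `G h` are bounded by `M`, whereas `‖G h‖ ^ n` is not controlled.
  have htel : ∀ h : ℝ, 0 < h → ∀ (n k : ℕ),
      ‖(G h ^ k) (S (n * h) x - (G h ^ n) x)‖ ≤ n * (M * (M * ‖S h x - G h x‖)) := by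
    intro h hh n
    induction n with
    | zero => intro k; simp [hS.map_zero_apply]
    | succ n ih =>
      intro k
      have hn : 0 ≤ (n : ℝ) * h := by positivity
      have h1 : S ((n + 1 : ℕ) * h) x - (G h ^ (n + 1)) x =
          S (n * h) (S h x - G h x) + G h (S (n * h) x - (G h ^ n) x) := by
        have h2 : ((n + 1 : ℕ) : ℝ) * h = n * h + h := by push_cast; ring
        have h3 : (G h ^ (n + 1)) x = G h ((G h ^ n) x) := by rw [pow_succ']; rfl
        rw [h2, hS.map_add_apply hn hh.le, h3, map_sub, map_sub, hcomm h hh _ hn]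
        abel
      have h4 : (G h ^ k) (G h (S (n * h) x - (G h ^ n) x)) =
          (G h ^ (k + 1)) (S (n * h) x - (G h ^ n) x) := by rw [pow_succ]; rfl
      rw [h1, map_add, h4]
      refine (norm_add_le _ _).trans ?_
      have h5 := (hGb h hh k (S (n * h) (S h x - G h x))).trans
        (mul_le_mul_of_nonneg_left (hSb _ hn _) hM)
      have h6 := ih (k + 1)
      rw [Nat.cast_succ, add_one_mul, add_comm ((n : ℝ) * _)]
      exact add_le_add h5 h6
  -- Consistency: `S h x - x` and `G h x - x` have the same first-order term `h (y - λ x)`.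
  have hlim : Tendsto (fun h : ℝ => h⁻¹ • (S h x - G h x)) (𝓝[>] 0) (𝓝 0) := by
    have h1 : Tendsto (fun h : ℝ => h⁻¹ • (S h x - x)) (𝓝[>] 0) (𝓝 (y - lam • x)) :=
      IsGeneratorPair.expShift ((hA _ _).1 hxy) lam
    have h2 := (tendsto_smul_resolventOp hT hA hb hlam (y - lam • x)).comp
      tendsto_inv_nhdsGT_zero
    have h3 := h1.sub h2
    rw [sub_self] at h3
    refine h3.congr' ?_
    filter_upwards [self_mem_nhdsWithin] with h (hh : 0 < h)
    rw [Function.comp_apply, ← smul_resolventOp_sub (hl h hh) hxy, ← smul_sub]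
    congr 1
    rw [hG]
    simp
  have hseq : Tendsto (fun n : ℕ => t / (n : ℝ)) atTop (𝓝[>] 0) := by
    refine tendsto_nhdsWithin_of_tendsto_nhds_of_eventually_within _
      (tendsto_const_div_atTop_nhds_zero_nat t) ?_
    filter_upwards [eventually_gt_atTop 0] with n hn
    exact div_pos ht (Nat.cast_pos.2 hn)
  rw [tendsto_iff_norm_sub_tendsto_zero]
  have h1 : Tendsto (fun n : ℕ => t * (M * (M * ‖(t / (n : ℝ))⁻¹ •
      (S (t / n) x - G (t / n) x)‖))) atTop (𝓝 0) := by
    simpa using ((((hlim.comp hseq).norm.const_mul M).const_mul M).const_mul t)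
  refine squeeze_zero' (Eventually.of_forall fun _ => norm_nonneg _) ?_ h1
  filter_upwards [eventually_gt_atTop 0] with n hn
  have hn0 : (n : ℝ) ≠ 0 := Nat.cast_ne_zero.2 hn.ne'
  have hh : 0 < t / (n : ℝ) := div_pos ht (Nat.cast_pos.2 hn)
  have h2 := htel _ hh n 0
  rw [pow_zero, one_apply_eq_self, mul_div_cancel₀ _ hn0, hGpow, inv_div,
    norm_sub_rev] at h2
  refine h2.trans (le_of_eq ?_)
  rw [norm_smul, Real.norm_of_nonneg (inv_pos.2 hh).le]
  field_simp

/-- A closed convex cone that is invariant under the resolvents is invariant under the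
semigroup. -/
theorem semigroup_mem (hT : IsC0Semigroup T) (hA : IsGenerator A T)
    (hb : ∀ t : ℝ, 0 ≤ t → ‖T t‖ ≤ M * Real.exp (w * t)) {lam : ℝ} (hlam : w < lam)
    {C : Set X} (hC : IsClosedConvexCone C)
    (hinv : ∀ mu : ℝ, lam ≤ mu → ∀ x ∈ C, resolventOp A (mu : 𝕜) x ∈ C)
    {t : ℝ} (ht : 0 ≤ t) {x : X} (hx : x ∈ C) : T t x ∈ C := by
  rcases ht.eq_or_lt with rfl | ht
  · rwa [hT.map_zero_apply]
  have hpow : ∀ mu : ℝ, lam ≤ mu → ∀ n : ℕ, ∀ z ∈ C, (resolventOp A (mu : 𝕜) ^ n) z ∈ C := by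
    intro mu hmu n z hz
    induction n with
    | zero => simpa using hz
    | succ n ih => rw [pow_succ']; exact hinv mu hmu _ ih
  have hdom : ∀ z ∈ C, ∀ z', (z, z') ∈ A.graph → T t z ∈ C := by
    intro z hz z' hzz
    rw [← exp_smul_expShift_apply lam t z]
    refine hC.smul_mem _ (Real.exp_pos _).le _ (hC.isClosed.mem_of_tendsto
      (tendsto_euler hT hA hb hlam hzz ht) (Eventually.of_forall fun n => ?_))
    exact hC.smul_mem _ (by positivity) _
      (hpow _ (le_add_of_nonneg_right (by positivity)) n z hz)
  -- A general `x ∈ C` is the limit of `μ R(λ+μ) x`, which lies in `C` and in the domain, where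
  -- Euler's formula applies.
  refine hC.isClosed.mem_of_tendsto (((T t).continuous.tendsto x).comp
    (tendsto_smul_resolventOp hT hA hb hlam x)) ?_
  filter_upwards [eventually_ge_atTop 0] with mu hmu
  have h1 : ((lam + mu : ℝ) : 𝕜) ∈ resolventSetOf A :=
    mem_resolventSetOf hT hA hb (by linarith)
  rw [Function.comp_apply, ContinuousLinearMap.map_smul_of_tower]
  exact hC.smul_mem _ hmu _
    (hdom _ (hinv _ (by linarith) x hx) _ ((resolventOp_spec h1).1 x))

/-- Neumann series: invariance under the resolvent at `lam` is inherited by the resolvents at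
smaller real points. -/
theorem resolventOp_mem_of_le (hT : IsC0Semigroup T) (hA : IsGenerator A T)
    (hb : ∀ t : ℝ, 0 ≤ t → ‖T t‖ ≤ M * Real.exp (w * t)) {lam mu : ℝ} (hmu : w < mu)
    (hml : mu ≤ lam) {C : Set X} (hC : IsClosedConvexCone C)
    (hinv : ∀ x ∈ C, resolventOp A (lam : 𝕜) x ∈ C) {x : X} (hx : x ∈ C) :
    resolventOp A (mu : 𝕜) x ∈ C := by
  have hlam : w < lam := hmu.trans_le hml
  have hl := mem_resolventSetOf hT hA hb hlam
  have hm := mem_resolventSetOf hT hA hb hmu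
  set R := resolventOp A (lam : 𝕜) with hR
  set z := resolventOp A (mu : 𝕜) x with hz
  have hpow : ∀ n : ℕ, (R ^ (n + 1)) x ∈ C := by
    intro n
    induction n with
    | zero => simpa using hinv x hx
    | succ n ih => rw [pow_succ']; exact hinv _ ih
  -- Iteration of the resolvent identity `z = R x + (λ - μ) R z`. The remainder vanishes by the
  -- Hille-Yosida estimate, since `(λ - μ) / (λ - w) < 1`.
  have h1 : ∀ n : ℕ, z = ∑ k ∈ Finset.range n, (lam - mu) ^ k • (R ^ (k + 1)) x +
      (lam - mu) ^ n • (R ^ n) z := by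
    intro n
    induction n with
    | zero => simp
    | succ n ih =>
      have h2 : z = R x + (lam - mu) • R z := by
        rw [RCLike.real_smul_eq_coe_smul (K := 𝕜), RCLike.ofReal_sub]
        exact resolventOp_identity hl hm x
      have h3 : (R ^ n) z = (R ^ (n + 1)) x + (lam - mu) • (R ^ (n + 1)) z := by
        conv_lhs => rw [h2]
        rw [map_add, ContinuousLinearMap.map_smul_of_tower, pow_succ]
        rfl
      rw [h3] at ih
      rw [Finset.sum_range_succ, add_assoc, pow_succ (lam - mu), mul_smul, ← smul_add]
      exact ih
  have hq : (lam - mu) / (lam - w) < 1 := (div_lt_one (sub_pos.2 hlam)).2 (by linarith)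
  have hq0 : 0 ≤ (lam - mu) / (lam - w) := div_nonneg (sub_nonneg.2 hml) (sub_pos.2 hlam).le
  have h2 : Tendsto (fun n : ℕ => (lam - mu) ^ n • (R ^ n) z) atTop (𝓝 0) := by
    have h3 : Tendsto (fun n : ℕ => ((lam - mu) / (lam - w)) ^ n * (M * ‖z‖)) atTop (𝓝 0) := by
      simpa using (tendsto_pow_atTop_nhds_zero_of_lt_one hq0 hq).mul_const (M * ‖z‖)
    refine squeeze_zero_norm (fun n => ?_) h3
    rw [norm_smul, norm_pow, Real.norm_of_nonneg (sub_nonneg.2 hml)]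
    calc (lam - mu) ^ n * ‖(R ^ n) z‖ ≤ (lam - mu) ^ n * (M * ‖z‖ / (lam - w) ^ n) := by
          exact mul_le_mul_of_nonneg_left (norm_resolventOp_pow_le hT hA hb hlam n z)
            (pow_nonneg (sub_nonneg.2 hml) n)
      _ = ((lam - mu) / (lam - w)) ^ n * (M * ‖z‖) := by rw [div_pow]; ring
  have h4 : Tendsto (fun n : ℕ => ∑ k ∈ Finset.range n, (lam - mu) ^ k • (R ^ (k + 1)) x) atTop
      (𝓝 z) := by
    have := h2.const_sub z
    rw [sub_zero] at this
    exact this.congr fun n => sub_eq_of_eq_add (h1 n)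
  refine hC.isClosed.mem_of_tendsto h4 (Eventually.of_forall fun n => hC.sum_mem _ fun k _ => ?_)
  exact hC.smul_mem _ (pow_nonneg (sub_nonneg.2 hml) k) _ (hpow k)

end Approximations

/-- Convex cones containing `0`. -/
structure IsPointedConvexCone {E : Type*} [AddCommGroup E] [Module ℝ E] (P : Set E) : Prop where
  zero_mem : (0 : E) ∈ P
  add_mem : ∀ x ∈ P, ∀ y ∈ P, x + y ∈ P
  smul_mem : ∀ c : ℝ, 0 ≤ c → ∀ x ∈ P, c • x ∈ P

theorem BanachLatticeOver.isPointedConvexCone_posCone {𝕜 E Er : Type*} [RCLike 𝕜]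
    [NormedAddCommGroup E] [NormedSpace 𝕜 E] [NormedSpace ℝ E] [IsScalarTower ℝ 𝕜 E]
    [NormedAddCommGroup Er] [Lattice Er] [IsOrderedAddMonoid Er] [HasSolidNorm Er]
    [NormedSpace ℝ Er] [IsOrderedModule ℝ Er] (L : BanachLatticeOver 𝕜 E Er) :
    IsPointedConvexCone L.posCone where
  zero_mem := ⟨0, le_rfl, (map_zero _).symm⟩
  add_mem := by
    rintro _ ⟨r, hr, rfl⟩ _ ⟨s, hs, rfl⟩
    exact ⟨r + s, add_nonneg hr hs, (map_add _ _ _).symm⟩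
  smul_mem := by
    rintro c hc _ ⟨r, hr, rfl⟩
    exact ⟨c • r, smul_nonneg hc hr, (map_smul _ _ _).symm⟩

/-! ### Dirichlet operators and controllability values -/

namespace BoundaryControlSystem

variable {𝕜 X dX U : Type*} [RCLike 𝕜]
  [NormedAddCommGroup X] [NormedSpace 𝕜 X] [NormedSpace ℝ X]
  [NormedAddCommGroup dX] [NormedSpace 𝕜 dX]
  [NormedAddCommGroup U] [NormedSpace 𝕜 U]
  (S : BoundaryControlSystem 𝕜 X dX U)

theorem isGenerator : IsGenerator S.A S.T := S.T_generator

theorem exists_of_mem_graph {x y : X} (h : (x, y) ∈ S.A.graph) :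
    ∃ z : S.Am.domain, (z : X) = x ∧ S.Am z = y ∧ S.Q z = 0 := by
  obtain ⟨a, ha1, ha2⟩ := (LinearPMap.mem_graph_iff _).1 h
  have had : (a : X) ∈ S.Am.domain := a.2.2
  have haA : S.A a = S.Am ⟨a, had⟩ := LinearPMap.domRestrict_apply rfl
  refine ⟨⟨a, had⟩, ha1, haA.symm.trans ha2, ?_⟩
  obtain ⟨z, hz, hza⟩ := Submodule.mem_map.1 a.2.1
  have : (⟨a, had⟩ : S.Am.domain) = z := Subtype.ext hza.symm
  rw [this]
  exact LinearMap.mem_ker.1 hz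

theorem dirichlet_spec {lam : 𝕜} (hl : lam ∈ resolventSetOf S.A) (d : dX) :
    ∃ z : S.Am.domain, (z : X) = S.dirichlet lam d ∧ S.Am z = lam • (z : X) ∧ S.Q z = d := by
  have h := (S.existsUnique_dirichlet hl d).exists
  refine ⟨h.choose, ?_, h.choose_spec⟩
  unfold dirichlet
  rw [dif_pos h]

theorem dirichlet_eq {lam : 𝕜} (hl : lam ∈ resolventSetOf S.A) {d : dX} {z : S.Am.domain}
    (h1 : S.Am z = lam • (z : X)) (h2 : S.Q z = d) : S.dirichlet lam d = z := by
  obtain ⟨z', h0, h'⟩ := S.dirichlet_spec hl d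
  rw [← h0, (S.existsUnique_dirichlet hl d).unique h' ⟨h1, h2⟩]

/-- The Dirichlet operators are bounded. -/
theorem exists_clm_dirichlet [CompleteSpace X] [CompleteSpace dX] {lam : 𝕜}
    (hl : lam ∈ resolventSetOf S.A) : ∃ L : dX →L[𝕜] X, ∀ d, L d = S.dirichlet lam d := by
  choose z hz1 hz2 hz3 using S.dirichlet_spec hl
  let g : dX →ₗ[𝕜] X :=
    { toFun := S.dirichlet lam
      map_add' := fun d e => by
        rw [← hz1 d, ← hz1 e, ← Submodule.coe_add]
        refine S.dirichlet_eq hl ?_ ?_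
        · rw [LinearPMap.map_add, hz2, hz2, Submodule.coe_add, smul_add]
        · rw [map_add, hz3, hz3]
      map_smul' := fun c d => by
        rw [RingHom.id_apply, ← hz1 d, ← Submodule.coe_smul]
        refine S.dirichlet_eq hl ?_ ?_
        · rw [LinearPMap.map_smul, hz2, Submodule.coe_smul, smul_comm]
        · rw [map_smul, hz3] }
  have hg : Continuous g := by
    -- Closed graph theorem. Closedness of `Am` puts the limit in `ker (λ - Am)`; there the graph
    -- norm is a multiple of the norm, so `Q` passes to the limit.
    refine LinearMap.continuous_of_seq_closed_graph g fun u d x hu hgu => ?_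
    have h1 : Tendsto (fun n => (z (u n) : X)) atTop (𝓝 x) :=
      hgu.congr fun n => (hz1 (u n)).symm
    have h2 : (x, lam • x) ∈ S.Am.graph := by
      refine IsClosed.mem_of_tendsto S.Am_closed (h1.prodMk_nhds (h1.const_smul lam))
        (Eventually.of_forall fun n => ?_)
      rw [← hz2]
      exact S.Am.mem_graph (z (u n))
    obtain ⟨x', hx1, hx2⟩ := (LinearPMap.mem_graph_iff _).1 h2
    dsimp only at hx1 hx2
    obtain ⟨C, hC⟩ := S.Q_bounded
    have h3 : Tendsto (fun n => S.Q (z (u n) - x')) atTop (𝓝 0) := by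
      have h4 : Tendsto (fun n => (z (u n) : X) - x) atTop (𝓝 0) := by
        simpa using h1.sub_const x
      have h5 : Tendsto (fun n => C * (‖(z (u n) : X) - x‖ + ‖lam • ((z (u n) : X) - x)‖))
          atTop (𝓝 0) := by
        simpa using (h4.norm.add (h4.const_smul lam).norm).const_mul C
      refine squeeze_zero_norm (fun n => ?_) h5
      have h6 := hC (z (u n) - x')
      rwa [LinearPMap.map_sub, hz2, hx2, AddSubgroupClass.coe_sub, hx1, ← smul_sub] at h6
    have h7 : Tendsto (fun n => u n - S.Q x') atTop (𝓝 (d - S.Q x')) := hu.sub_const _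
    have h8 := tendsto_nhds_unique (h7.congr fun n => by rw [map_sub, hz3]) h3
    have h9 := S.dirichlet_eq hl (z := x') (by rw [hx2, hx1]) (sub_eq_zero.1 h8).symm
    rw [← hx1, ← h9]
    rfl
  exact ⟨⟨g, hg⟩, fun d => rfl⟩

theorem exists_clm_Bop [CompleteSpace X] [CompleteSpace dX] {lam : 𝕜}
    (hl : lam ∈ resolventSetOf S.A) : ∃ L : U →L[𝕜] X, ∀ v, L v = S.Bop lam v := by
  obtain ⟨L, hL⟩ := S.exists_clm_dirichlet hl
  exact ⟨L.comp S.B, fun v => hL _⟩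

/-- Subtracting an element of `D(A) = ker Q` keeps the boundary value, and this particular one moves
`B_λ v` into `ker (μ - Am)`. -/
theorem Bop_eq_sub {lam mu : 𝕜} (hl : lam ∈ resolventSetOf S.A) (hm : mu ∈ resolventSetOf S.A)
    (v : U) :
    S.Bop mu v = S.Bop lam v - (mu - lam) • resolventOp S.A mu (S.Bop lam v) := by
  obtain ⟨z, hz1, hz2, hz3⟩ := S.dirichlet_spec hl (S.B v)
  obtain ⟨y, hy1, hy2, hy3⟩ := S.exists_of_mem_graph ((resolventOp_spec hm).1 (S.Bop lam v))
  have h1 : S.dirichlet mu (S.B v) = (z - (mu - lam) • y : S.Am.domain) := by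
    refine S.dirichlet_eq hm ?_ ?_
    · rw [LinearPMap.map_sub, LinearPMap.map_smul, hz2, hy2, ← hy1, Bop, ← hz1,
        AddSubgroupClass.coe_sub, Submodule.coe_smul]
      module
    · rw [map_sub, map_smul, hy3, hz3, smul_zero, sub_zero]
  rw [Bop, h1, AddSubgroupClass.coe_sub, Submodule.coe_smul, hy1, hz1, Bop]

/-- As graph membership, linearity in the control and changes of `λ` reduce to the graph being a
subspace. -/
theorem isControllabilityValue_iff {lam : 𝕜} {t : ℝ} {u : ℝ → U} {x : X} :
    S.IsControllabilityValue lam t u x ↔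
      (S.inputIntegral lam t u, lam • S.inputIntegral lam t u - x) ∈ S.A.graph := by
  constructor
  · rintro ⟨h, rfl⟩
    rw [sub_sub_cancel]
    exact S.A.mem_graph ⟨_, h⟩
  · intro h
    obtain ⟨y, hy1, hy2⟩ := (LinearPMap.mem_graph_iff _).1 h
    dsimp only at hy1 hy2
    have hd : S.inputIntegral lam t u ∈ S.A.domain := hy1 ▸ y.2
    refine ⟨hd, ?_⟩
    have : y = ⟨_, hd⟩ := Subtype.ext hy1
    rw [← this, hy2, sub_sub_cancel]

theorem inputIntegral_eq {lam : 𝕜} {t : ℝ} (ht : 0 ≤ t) (u : ℝ → U) :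
    S.inputIntegral lam t u = ∫ s in Icc 0 t, S.T (t - s) (S.Bop lam (u s)) := by
  rw [inputIntegral, intervalIntegral.integral_of_le ht, integral_Icc_eq_integral_Ioc]

/-! ### Cone structure of the exactly reachable states -/

section Controls

variable [IsScalarTower ℝ 𝕜 X] [CompleteSpace X] [CompleteSpace dX]

theorem integrable_input {lam : 𝕜} (hl : lam ∈ resolventSetOf S.A) {t : ℝ} {u : ℝ → U}
    (hu : Integrable u (volume.restrict (Icc 0 t))) :
    Integrable (fun s => S.T (t - s) (S.Bop lam (u s))) (volume.restrict (Icc 0 t)) := by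
  obtain ⟨L, hL⟩ := S.exists_clm_Bop hl
  refine S.T_semigroup.integrable_convolution ?_
  simpa only [hL] using L.integrable_comp hu

theorem inputIntegral_eq_sub {lam mu : 𝕜} (hl : lam ∈ resolventSetOf S.A)
    (hm : mu ∈ resolventSetOf S.A) {t : ℝ} (ht : 0 ≤ t) {u : ℝ → U}
    (hu : Integrable u (volume.restrict (Icc 0 t))) :
    S.inputIntegral mu t u = S.inputIntegral lam t u -
      (mu - lam) • resolventOp S.A mu (S.inputIntegral lam t u) := by
  have hi := S.integrable_input hl hu
  rw [S.inputIntegral_eq ht, S.inputIntegral_eq ht, ← ContinuousLinearMap.integral_comp_comm _ hi,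
    ← integral_smul]
  have hi' : Integrable (fun s => (mu - lam) • resolventOp S.A mu
      (S.T (t - s) (S.Bop lam (u s)))) (volume.restrict (Icc 0 t)) :=
    ((resolventOp S.A mu).integrable_comp hi).smul (mu - lam)
  rw [← integral_sub hi hi']
  refine setIntegral_congr_fun measurableSet_Icc fun s hs => ?_
  rw [S.Bop_eq_sub hl hm, map_sub, map_smul]
  rw [resolventOp_commute S.T_semigroup S.isGenerator hm (sub_nonneg.2 hs.2)]

/-- The controllability map does not depend on the point of the resolvent set. -/
theorem IsControllabilityValue.change {S : BoundaryControlSystem 𝕜 X dX U} {lam mu : 𝕜}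
    (hl : lam ∈ resolventSetOf S.A)
    (hm : mu ∈ resolventSetOf S.A) {t : ℝ} (ht : 0 ≤ t) {u : ℝ → U}
    (hu : Integrable u (volume.restrict (Icc 0 t))) {x : X}
    (h : S.IsControllabilityValue lam t u x) : S.IsControllabilityValue mu t u x := by
  rw [isControllabilityValue_iff] at h ⊢
  rw [S.inputIntegral_eq_sub hl hm ht hu]
  set I := S.inputIntegral lam t u
  have h1 := S.A.graph.sub_mem h (S.A.graph.smul_mem (mu - lam) ((resolventOp_spec hm).1 I))
  convert h1 using 1
  ext1
  · rfl
  · simp only [Prod.snd_sub, Prod.smul_snd]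
    module

variable [NormedSpace ℝ U] [IsScalarTower ℝ 𝕜 U] {p : ℝ≥0∞} {P : Set U}

theorem exactPosReach_add_mem (hp : 1 ≤ p) (hP : IsPointedConvexCone P) {t : ℝ} (ht : 0 ≤ t)
    {x y : X} (hx : x ∈ S.exactPosReach p P t) (hy : y ∈ S.exactPosReach p P t) :
    x + y ∈ S.exactPosReach p P t := by
  obtain ⟨lam, hl, u, hu, huP, hux⟩ := hx
  obtain ⟨mu, hm, v, hv, hvP, hvy⟩ := hy
  have hui := hu.integrable hp
  have hvi := hv.integrable hp
  refine ⟨lam, hl, u + v, hu.add hv, ?_, ?_⟩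
  · filter_upwards [huP, hvP] with s h1 h2 using hP.add_mem _ h1 _ h2
  · replace hvy := hvy.change hm hl ht hvi
    rw [isControllabilityValue_iff] at hux hvy ⊢
    obtain ⟨L, hL⟩ := S.exists_clm_Bop hl
    have h1 : S.inputIntegral lam t (u + v) =
        S.inputIntegral lam t u + S.inputIntegral lam t v := by
      simp only [S.inputIntegral_eq ht]
      rw [← integral_add (S.integrable_input hl hui) (S.integrable_input hl hvi)]
      simp only [← hL, Pi.add_apply, map_add]
    rw [h1]
    convert S.A.graph.add_mem hux hvy using 1
    ext1
    · rfl
    · simp only [Prod.snd_add]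
      module

theorem exactPosReach_smul_mem (hP : IsPointedConvexCone P) {t : ℝ} (ht : 0 ≤ t)
    {c : ℝ} (hc : 0 ≤ c) {x : X} (hx : x ∈ S.exactPosReach p P t) :
    c • x ∈ S.exactPosReach p P t := by
  obtain ⟨lam, hl, u, hu, huP, hux⟩ := hx
  refine ⟨lam, hl, c • u, hu.const_smul c, ?_, ?_⟩
  · filter_upwards [huP] with s h1 using hP.smul_mem c hc _ h1
  · rw [isControllabilityValue_iff] at hux ⊢
    obtain ⟨L, hL⟩ := S.exists_clm_Bop hl
    have h1 : S.inputIntegral lam t (c • u) = (c : 𝕜) • S.inputIntegral lam t u := by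
      simp only [S.inputIntegral_eq ht]
      rw [← integral_smul]
      simp only [← hL, Pi.smul_apply, RCLike.real_smul_eq_coe_smul (K := 𝕜), map_smul]
    rw [h1, RCLike.real_smul_eq_coe_smul (K := 𝕜)]
    convert S.A.graph.smul_mem (c : 𝕜) hux using 1
    ext1
    · rfl
    · simp only [Prod.smul_snd]
      module

/-! ### Pulse states and the first representation -/

theorem Bop_smul {lam : 𝕜} (hl : lam ∈ resolventSetOf S.A) (c : ℝ) (v : U) :
    S.Bop lam (c • v) = c • S.Bop lam v := by
  obtain ⟨L, hL⟩ := S.exists_clm_Bop hl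
  rw [← hL, ← hL, L.map_smul_of_tower]

/-- The states reached with controls that are exponential on a time interval and zero outside. -/
def pulseStates (P : Set U) (lam : ℝ) : Set X :=
  {x : X | ∃ α β t : ℝ, ∃ v ∈ P, 0 ≤ α ∧ α ≤ β ∧ β ≤ t ∧
    x = Real.exp (lam * β) • S.T (t - β) (S.Bop (lam : 𝕜) v)
      - Real.exp (lam * α) • S.T (t - α) (S.Bop (lam : 𝕜) v)}

/-- The control is `exp (λ s) v` on `(α, β]` and `0` elsewhere. The exponential combines with `T(t -
s)` into the rescaled semigroup, so the input integral is an orbit integral, on which `λ - A` gives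
the difference of the endpoint values. -/
theorem pulse_mem_exactPosReach (hP : IsPointedConvexCone P) {lam : ℝ}
    (hl : (lam : 𝕜) ∈ resolventSetOf S.A) {α β t : ℝ} (hα : 0 ≤ α) (hαβ : α ≤ β) (hβ : β ≤ t)
    {v : U} (hv : v ∈ P) :
    Real.exp (lam * β) • S.T (t - β) (S.Bop (lam : 𝕜) v)
      - Real.exp (lam * α) • S.T (t - α) (S.Bop (lam : 𝕜) v) ∈ S.exactPosReach p P t := by
  have ht : 0 ≤ t := by linarith
  set y := S.Bop (lam : 𝕜) v with hy
  set u : ℝ → U := (Ioc α β).indicator fun s => Real.exp (lam * s) • v with hu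
  have hT := S.T_semigroup
  have hE := isC0Semigroup_expShift hT lam
  refine ⟨lam, hl, u, ?_, ?_, ?_⟩
  · have hcont : Continuous fun s : ℝ => Real.exp (lam * s) • v := by fun_prop
    obtain ⟨K, hK⟩ := (isCompact_Icc (a := (0 : ℝ)) (b := t)).exists_bound_of_continuousOn
      hcont.continuousOn
    refine MemLp.of_bound (hcont.aestronglyMeasurable.indicator measurableSet_Ioc) K ?_
    refine ae_restrict_of_forall_mem measurableSet_Icc fun s hs => ?_
    exact (norm_indicator_le_norm_self _ _).trans (hK s hs)
  · refine Eventually.of_forall fun s => ?_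
    by_cases hs : s ∈ Ioc α β
    · rw [hu, indicator_of_mem hs]
      exact hP.smul_mem _ (Real.exp_pos _).le _ hv
    · rw [hu, indicator_of_notMem hs]
      exact hP.zero_mem
  · have h1 : S.inputIntegral lam t u =
        Real.exp (lam * t) • ∫ s in (t - β)..(t - α), expShift lam S.T s y := by
      have h2 : (fun s => S.T (t - s) (S.Bop (lam : 𝕜) (u s))) = (Ioc α β).indicator
          fun s => Real.exp (lam * t) • expShift lam S.T (t - s) y := by
        funext s
        by_cases hs : s ∈ Ioc α β
        · rw [hu, indicator_of_mem hs, indicator_of_mem hs, S.Bop_smul hl,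
            ContinuousLinearMap.map_smul_of_tower, expShift_apply, smul_smul, ← Real.exp_add]
          congr 2
          ring
        · rw [hu, indicator_of_notMem hs, indicator_of_notMem hs]
          have := S.Bop_smul hl 0 (0 : U)
          rw [zero_smul, zero_smul] at this
          rw [this, map_zero]
      rw [inputIntegral, h2, intervalIntegral.integral_of_le ht,
        setIntegral_indicator measurableSet_Ioc,
        inter_eq_self_of_subset_right (Ioc_subset_Ioc hα hβ),
        ← intervalIntegral.integral_of_le hαβ, intervalIntegral.integral_smul,
        intervalIntegral.integral_comp_sub_left (fun s => expShift lam S.T s y) t]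
    rw [isControllabilityValue_iff, h1]
    refine (S.isGenerator _ _).2 ((isGeneratorPair_expShift_iff lam).1 ?_)
    have h2 := (hE.isGeneratorPair_integral y (sub_nonneg.2 hβ)
      (sub_nonneg.2 (hαβ.trans hβ))).smul (Real.exp (lam * t))
    rw [RCLike.real_smul_eq_coe_smul (K := 𝕜) lam, sub_sub, add_comm, ← sub_sub, sub_self,
      zero_sub, neg_sub]
    convert h2 using 1
    rw [smul_sub, expShift_apply, expShift_apply, smul_smul, smul_smul, ← Real.exp_add,
      ← Real.exp_add]
    congr 4 <;> ring

/-- Delaying the pulse by `t' - t` and scaling `v` by `exp (-λ (t' - t))` produces the same state at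
the later time `t'`. Any two pulse states thus have a common reaching time, so their convex
combinations are reachable too. -/
theorem exists_pulseStates_mem (hP : IsPointedConvexCone P) {lam : ℝ}
    (hl : (lam : 𝕜) ∈ resolventSetOf S.A) {x : X} (hx : x ∈ S.pulseStates P lam) :
    ∃ t : ℝ, 0 ≤ t ∧ ∀ t' : ℝ, t ≤ t' → x ∈ S.exactPosReach p P t' := by
  obtain ⟨α, β, t, v, hv, hα, hαβ, hβ, rfl⟩ := hx
  refine ⟨t, by linarith, fun t' ht' => ?_⟩
  have h1 := S.pulse_mem_exactPosReach (p := p) hP hl (α := α + (t' - t)) (β := β + (t' - t))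
    (t := t') (by linarith) (by linarith) (by linarith)
    (hP.smul_mem (Real.exp (-(lam * (t' - t)))) (Real.exp_pos _).le v hv)
  rw [S.Bop_smul hl, ContinuousLinearMap.map_smul_of_tower, ContinuousLinearMap.map_smul_of_tower,
    smul_smul, smul_smul, ← Real.exp_add, ← Real.exp_add] at h1
  convert h1 using 5 <;> ring

theorem pulseStates_smul_mem (hP : IsPointedConvexCone P) {lam : ℝ}
    (hl : (lam : 𝕜) ∈ resolventSetOf S.A) (c : ℝ) (hc : 0 ≤ c) (x : X)
    (hx : x ∈ S.pulseStates P lam) : c • x ∈ S.pulseStates P lam := by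
  obtain ⟨α, β, t, v, hv, hα, hαβ, hβ, rfl⟩ := hx
  refine ⟨α, β, t, c • v, hP.smul_mem c hc v hv, hα, hαβ, hβ, ?_⟩
  rw [S.Bop_smul hl, ContinuousLinearMap.map_smul_of_tower, ContinuousLinearMap.map_smul_of_tower,
    smul_sub, smul_comm c, smul_comm c]

theorem isClosedConvexCone_pulseStates (hP : IsPointedConvexCone P) {lam : ℝ}
    (hl : (lam : 𝕜) ∈ resolventSetOf S.A) :
    IsClosedConvexCone (closedConvexHull ℝ (S.pulseStates P lam)) := by
  refine isClosedConvexCone_closedConvexHull ?_ (S.pulseStates_smul_mem hP hl)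
  exact ⟨0, 0, 0, 0, hP.zero_mem, le_rfl, le_rfl, le_rfl, by simp⟩

theorem closedConvexHull_pulseStates_subset (hp : 1 ≤ p) (hP : IsPointedConvexCone P) {lam : ℝ}
    (hl : (lam : 𝕜) ∈ resolventSetOf S.A) :
    closedConvexHull ℝ (S.pulseStates P lam) ⊆ S.approxPosReach p P := by
  set K : Set X := {x | ∃ t : ℝ, 0 ≤ t ∧ ∀ t' : ℝ, t ≤ t' → x ∈ S.exactPosReach p P t'} with hK
  have hconv : Convex ℝ K := by
    rintro x ⟨t, ht, hx⟩ y ⟨s, hs, hy⟩ a b ha hb -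
    refine ⟨max t s, le_max_of_le_left ht, fun t' ht' => ?_⟩
    have ht0 : 0 ≤ t' := (le_max_of_le_left ht).trans ht'
    exact S.exactPosReach_add_mem hp hP ht0
      (S.exactPosReach_smul_mem hP ht0 ha (hx t' ((le_max_left _ _).trans ht')))
      (S.exactPosReach_smul_mem hP ht0 hb (hy t' ((le_max_right _ _).trans ht')))
  refine (closedConvexHull_min (fun x hx => subset_closure
    (S.exists_pulseStates_mem (p := p) hP hl hx)) hconv.closure isClosed_closure).trans
    (closure_mono ?_)
  rintro x ⟨t, ht, hx⟩
  exact mem_iUnion₂.2 ⟨t, ht, subset_closure (hx t le_rfl)⟩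

/-- The state is the limit of `h⁻¹ (I - S(h) I)`, with `I` the input integral and `S` the rescaled
semigroup, and the integrand of `I - S(h) I` is a pulse state for almost every `s`. -/
theorem exactPosReach_subset (hp : 1 ≤ p) (hP : IsPointedConvexCone P) {lam : ℝ}
    (hl : (lam : 𝕜) ∈ resolventSetOf S.A) {t : ℝ} (ht : 0 ≤ t) :
    S.exactPosReach p P t ⊆ closedConvexHull ℝ (S.pulseStates P lam) := by
  rintro x ⟨mu, hm, u, hu, huP, hux⟩
  have hui := hu.integrable hp
  replace hux := hux.change hm hl ht hui
  rw [isControllabilityValue_iff] at hux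
  set I := S.inputIntegral lam t u with hI
  have hC := S.isClosedConvexCone_pulseStates hP hl
  have hT := S.T_semigroup
  have hi := S.integrable_input hl hui
  have h1 := IsGeneratorPair.expShift ((S.isGenerator _ _).1 hux) lam
  rw [RCLike.real_smul_eq_coe_smul (K := 𝕜) lam, sub_sub, add_comm, ← sub_sub, sub_self,
    zero_sub] at h1
  have h2 := Tendsto.neg h1
  rw [neg_neg] at h2
  refine hC.isClosed.mem_of_tendsto h2 ?_
  filter_upwards [self_mem_nhdsWithin] with h (hh : 0 < h)
  rw [← smul_neg, neg_sub]
  refine hC.smul_mem _ (inv_pos.2 hh).le _ ?_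
  rw [hI, S.inputIntegral_eq ht, ← ContinuousLinearMap.integral_comp_comm _ hi,
    ← integral_sub hi ((expShift lam S.T h).integrable_comp hi)]
  refine hC.setIntegral_mem measure_Icc_lt_top.ne ?_
    (hi.sub ((expShift lam S.T h).integrable_comp hi))
  filter_upwards [huP, ae_restrict_mem measurableSet_Icc] with s hs1 hs2
  have hts : 0 ≤ t - s := sub_nonneg.2 hs2.2
  -- The pulse acts on `(0, h]` and is observed `t - s` later; the amplitude cancels the factor `exp
  -- (λ h)`.
  refine subset_closedConvexHull ⟨0, h, t - s + h, Real.exp (-(lam * h)) • u s,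
    hP.smul_mem _ (Real.exp_pos _).le _ hs1, le_rfl, hh.le, by linarith, ?_⟩
  rw [S.Bop_smul hl, ContinuousLinearMap.map_smul_of_tower, ContinuousLinearMap.map_smul_of_tower,
    smul_smul, ← Real.exp_add, add_neg_cancel, mul_zero, Real.exp_zero, one_smul, one_smul,
    add_sub_cancel_right, sub_zero, add_comm, hT.map_add_apply hh.le hts, expShift_apply]

/-- Every exactly reachable state is a derivative at `0` of averages of the semigroup over pulse
states, so neither admissibility of `B` nor positivity of the reachable states is needed here. -/
theorem approxPosReach_eq (hp : 1 ≤ p) (hP : IsPointedConvexCone P) {lam : ℝ}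
    (hl : (lam : 𝕜) ∈ resolventSetOf S.A) :
    S.approxPosReach p P = closedConvexHull ℝ (S.pulseStates P lam) := by
  refine Subset.antisymm (closure_minimal (iUnion₂_subset fun t ht => ?_)
    isClosed_closedConvexHull) (S.closedConvexHull_pulseStates_subset hp hP hl)
  exact closure_minimal (S.exactPosReach_subset hp hP hl ht) isClosed_closedConvexHull

theorem isClosedConvexCone_approxPosReach (hp : 1 ≤ p) (hP : IsPointedConvexCone P) {lam : ℝ}
    (hl : (lam : 𝕜) ∈ resolventSetOf S.A) : IsClosedConvexCone (S.approxPosReach p P) := by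
  rw [S.approxPosReach_eq hp hP hl]
  exact S.isClosedConvexCone_pulseStates hP hl

theorem semigroup_mem_approxPosReach (hp : 1 ≤ p) (hP : IsPointedConvexCone P) {lam : ℝ}
    (hl : (lam : 𝕜) ∈ resolventSetOf S.A) {r : ℝ} (hr : 0 ≤ r) {x : X}
    (hx : x ∈ S.approxPosReach p P) : S.T r x ∈ S.approxPosReach p P := by
  rw [S.approxPosReach_eq hp hP hl] at hx ⊢
  refine mapsTo_closedConvexHull ((S.T r).restrictScalars ℝ) convex_closedConvexHull
    isClosed_closedConvexHull ?_ hx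
  rintro _ ⟨α, β, t, v, hv, hα, hαβ, hβ, rfl⟩
  refine subset_closedConvexHull ⟨α, β, r + t, v, hv, hα, hαβ, by linarith, ?_⟩
  rw [ContinuousLinearMap.coe_restrictScalars', map_sub, ContinuousLinearMap.map_smul_of_tower,
    ContinuousLinearMap.map_smul_of_tower, add_sub_assoc, add_sub_assoc,
    S.T_semigroup.map_add_apply hr (sub_nonneg.2 hβ),
    S.T_semigroup.map_add_apply hr (sub_nonneg.2 (hαβ.trans hβ))]

/-! ### Representations by orbits and by resolvents -/

theorem Bop_mem_approxPosReach (hp : 1 ≤ p) (hP : IsPointedConvexCone P) {M w lam : ℝ}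
    (hb : ∀ t : ℝ, 0 ≤ t → ‖S.T t‖ ≤ M * Real.exp (w * t)) (hlam : w < lam)
    {v : U} (hv : v ∈ P) : S.Bop (lam : 𝕜) v ∈ S.approxPosReach p P := by
  have hl := mem_resolventSetOf S.T_semigroup S.isGenerator hb hlam
  rw [S.approxPosReach_eq hp hP hl]
  -- The pulse on `(0, t]` with amplitude `exp (-λ t)`, observed at time `t`, yields `B_λ v - exp
  -- (-λ t) T(t) B_λ v`.
  have h1 := (tendsto_expShift_zero hb hlam (S.Bop (lam : 𝕜) v)).const_sub (S.Bop (lam : 𝕜) v)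
  rw [sub_zero] at h1
  refine isClosed_closedConvexHull.mem_of_tendsto h1 ?_
  filter_upwards [eventually_ge_atTop 0] with t ht
  refine subset_closedConvexHull ⟨0, t, t, Real.exp (-(lam * t)) • v,
    hP.smul_mem _ (Real.exp_pos _).le _ hv, le_rfl, ht, le_rfl, ?_⟩
  rw [S.Bop_smul hl, ContinuousLinearMap.map_smul_of_tower, ContinuousLinearMap.map_smul_of_tower,
    smul_smul, ← Real.exp_add, add_neg_cancel, mul_zero, Real.exp_zero, one_smul, one_smul,
    sub_self, sub_zero, S.T_semigroup.map_zero_apply, expShift_apply]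

/-- A closed convex cone containing the orbits of the states `B_mu v` for all large `mu` contains
the states reached with exponential controls on an interval. -/
theorem sub_expShift_mem {M w lam : ℝ}
    (hb : ∀ t : ℝ, 0 ≤ t → ‖S.T t‖ ≤ M * Real.exp (w * t)) (hlam : w < lam)
    {C : Set X} (hC : IsClosedConvexCone C) {v : U}
    (hv : ∀ t : ℝ, 0 ≤ t → ∀ mu : ℝ, lam ≤ mu → S.T t (S.Bop (mu : 𝕜) v) ∈ C)
    {h : ℝ} (hh : 0 ≤ h) :
    S.Bop (lam : 𝕜) v - expShift lam S.T h (S.Bop (lam : 𝕜) v) ∈ C := by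
  have hT := S.T_semigroup
  have hE := isC0Semigroup_expShift hT lam
  have hl := mem_resolventSetOf hT S.isGenerator hb hlam
  set y := S.Bop (lam : 𝕜) v with hy
  set j := ∫ s in (0 : ℝ)..h, expShift lam S.T s y with hj
  have hpair := hE.isGeneratorPair_integral y le_rfl hh
  rw [hE.map_zero_apply, ← hj] at hpair
  have hgraph : (j, lam • j - (y - expShift lam S.T h y)) ∈ S.A.graph := by
    refine (S.isGenerator _ _).2 ((isGeneratorPair_expShift_iff lam).1 ?_)
    convert hpair using 1
    abel
  -- Smoothing by `μ R(λ+μ)` turns the difference into `μ` times an integral of rescaled orbits of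
  -- `B_{λ+μ} v`, hence into an element of the cone.
  refine hC.isClosed.mem_of_tendsto (tendsto_smul_resolventOp hT S.isGenerator hb hlam _) ?_
  filter_upwards [eventually_ge_atTop 0] with mu hmu
  have hlm : w < lam + mu := by linarith
  have hm := mem_resolventSetOf hT S.isGenerator hb hlm
  set R := resolventOp S.A ((lam + mu : ℝ) : 𝕜) with hR
  refine hC.smul_mem _ hmu _ ?_
  have h1 : mu • R j - j = R (lam • j - (y - expShift lam S.T h y) - lam • j) :=
    smul_resolventOp_sub hm hgraph
  rw [sub_sub, add_comm, ← sub_sub, sub_self, zero_sub, map_neg] at h1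
  have h2 : S.Bop ((lam + mu : ℝ) : 𝕜) v = y - mu • R y := by
    rw [S.Bop_eq_sub hl hm, RCLike.real_smul_eq_coe_smul (K := 𝕜) mu, RCLike.ofReal_add,
      add_sub_cancel_left, hR, RCLike.ofReal_add]
  have h3 : R (y - expShift lam S.T h y) =
      ∫ s in (0 : ℝ)..h, expShift lam S.T s (S.Bop ((lam + mu : ℝ) : 𝕜) v) := by
    have hi := fun z => hE.intervalIntegrable_orbit z le_rfl hh
    have h4 : R j = ∫ s in (0 : ℝ)..h, expShift lam S.T s (R y) := by
      rw [hj, ← ContinuousLinearMap.intervalIntegral_comp_comm _ (hi y)]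
      refine intervalIntegral.integral_congr fun s hs => ?_
      rw [uIcc_of_le hh] at hs
      simp only [expShift_apply, ContinuousLinearMap.map_smul_of_tower]
      rw [resolventOp_commute hT S.isGenerator hm hs.1]
    simp only [h2, map_sub, ContinuousLinearMap.map_smul_of_tower]
    have hi' : IntervalIntegrable (fun s => mu • expShift lam S.T s (R y)) volume 0 h :=
      (hi (R y)).smul mu
    rw [intervalIntegral.integral_sub (hi y) hi', intervalIntegral.integral_smul,
      ← h4, ← hj, ← map_sub, ← neg_sub (mu • R j) j, h1, neg_neg]
  rw [h3]
  exact hC.intervalIntegral_mem hh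
    (fun s hs => hC.smul_mem _ (Real.exp_pos _).le _ (hv s hs.1.le _ (by linarith)))
    (hE.intervalIntegrable_orbit _ le_rfl hh)

/-- A pulse state is `exp (λ β) T(t - β)` applied to `B_λ v - S(β - α) B_λ v`, with `S` the rescaled
semigroup. This criterion serves both remaining representations. -/
theorem approxPosReach_subset_of_orbits (hp : 1 ≤ p) (hP : IsPointedConvexCone P) {M w lam : ℝ}
    (hb : ∀ t : ℝ, 0 ≤ t → ‖S.T t‖ ≤ M * Real.exp (w * t)) (hlam : w < lam)
    {C : Set X} (hC : IsClosedConvexCone C) (hinv : ∀ t : ℝ, 0 ≤ t → ∀ x ∈ C, S.T t x ∈ C)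
    (hBC : ∀ v ∈ P, ∀ mu : ℝ, lam ≤ mu → S.Bop (mu : 𝕜) v ∈ C) :
    S.approxPosReach p P ⊆ C := by
  have hl := mem_resolventSetOf S.T_semigroup S.isGenerator hb hlam
  rw [S.approxPosReach_eq hp hP hl]
  refine closedConvexHull_min ?_ hC.convex hC.isClosed
  rintro _ ⟨α, β, t, v, hv, hα, hαβ, hβ, rfl⟩
  have h1 := hinv (t - β) (sub_nonneg.2 hβ) _ (S.sub_expShift_mem hb hlam hC (v := v)
    (fun r hr mu hmu => hinv r hr _ (hBC v hv mu hmu)) (sub_nonneg.2 hαβ))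
  have h2 := hC.smul_mem _ (Real.exp_pos (lam * β)).le _ h1
  convert h2 using 1
  have h3 : t - α = (t - β) + (β - α) := by ring
  rw [map_sub, smul_sub, expShift_apply, ContinuousLinearMap.map_smul_of_tower,
    ← S.T_semigroup.map_add_apply (sub_nonneg.2 hβ) (sub_nonneg.2 hαβ), smul_smul, ← Real.exp_add,
    ← h3]
  congr 3
  ring

theorem approxPosReach_eq_orbits (hp : 1 ≤ p) (hP : IsPointedConvexCone P) {M w₀ w : ℝ}
    (hb : ∀ t : ℝ, 0 ≤ t → ‖S.T t‖ ≤ M * Real.exp (w₀ * t)) (hw : w₀ < w) :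
    S.approxPosReach p P = closedConvexHull ℝ
      {x : X | ∃ t lam : ℝ, ∃ v ∈ P, 0 ≤ t ∧ w < lam ∧ x = S.T t (S.Bop (lam : 𝕜) v)} := by
  have hl : ∀ mu : ℝ, w < mu → (mu : 𝕜) ∈ resolventSetOf S.A := fun mu hmu =>
    mem_resolventSetOf S.T_semigroup S.isGenerator hb (hw.trans hmu)
  refine Subset.antisymm ?_ ?_
  · refine S.approxPosReach_subset_of_orbits hp hP hb (hw.trans (lt_add_one w)) ?_ ?_ ?_
    · refine isClosedConvexCone_closedConvexHull ?_ ?_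
      · refine ⟨0, w + 1, 0, hP.zero_mem, le_rfl, lt_add_one w, ?_⟩
        have := S.Bop_smul (hl _ (lt_add_one w)) 0 (0 : U)
        rw [zero_smul, zero_smul] at this
        rw [this, map_zero]
      · rintro c hc _ ⟨t, lam, v, hv, ht, hlam, rfl⟩
        refine ⟨t, lam, c • v, hP.smul_mem c hc v hv, ht, hlam, ?_⟩
        rw [S.Bop_smul (hl _ hlam), ContinuousLinearMap.map_smul_of_tower]
    · intro r hr x hx
      refine mapsTo_closedConvexHull ((S.T r).restrictScalars ℝ) convex_closedConvexHull
        isClosed_closedConvexHull ?_ hx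
      rintro _ ⟨t, lam, v, hv, ht, hlam, rfl⟩
      refine subset_closedConvexHull ⟨r + t, lam, v, hv, add_nonneg hr ht, hlam, ?_⟩
      rw [ContinuousLinearMap.coe_restrictScalars', S.T_semigroup.map_add_apply hr ht]
    · intro v hv mu hmu
      exact subset_closedConvexHull ⟨0, mu, v, hv, le_rfl, by linarith,
        (S.T_semigroup.map_zero_apply _).symm⟩
  · have hC := S.isClosedConvexCone_approxPosReach hp hP (hl _ (lt_add_one w))
    refine closedConvexHull_min ?_ hC.convex hC.isClosed
    rintro _ ⟨t, lam, v, hv, ht, hlam, rfl⟩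
    exact S.semigroup_mem_approxPosReach hp hP (hl _ hlam) ht
      (S.Bop_mem_approxPosReach hp hP hb (hw.trans hlam) hv)

theorem approxPosReach_eq_resolvents (hp : 1 ≤ p) (hP : IsPointedConvexCone P) {M w₀ w : ℝ}
    (hb : ∀ t : ℝ, 0 ≤ t → ‖S.T t‖ ≤ M * Real.exp (w₀ * t)) (hw : w₀ < w) :
    S.approxPosReach p P = closedConvexHull ℝ
      {x : X | ∃ n : ℕ, ∃ lam : ℝ, ∃ v ∈ P, w < lam ∧
        x = (resolventOp S.A (lam : 𝕜) ^ n) (S.Bop (lam : 𝕜) v)} := by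
  have hT := S.T_semigroup
  have hA := S.isGenerator
  have hl : ∀ mu : ℝ, w < mu → (mu : 𝕜) ∈ resolventSetOf S.A := fun mu hmu =>
    mem_resolventSetOf hT hA hb (hw.trans hmu)
  have hB0 : ∀ mu : ℝ, w < mu → S.Bop (mu : 𝕜) 0 = 0 := fun mu hmu => by
    simpa using S.Bop_smul (hl mu hmu) 0 (0 : U)
  have hpow : ∀ {C : Set X} {mu : ℝ}, (∀ x ∈ C, resolventOp S.A (mu : 𝕜) x ∈ C) →
      ∀ (n : ℕ), ∀ x ∈ C, (resolventOp S.A (mu : 𝕜) ^ n) x ∈ C := by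
    intro C mu hC n x hx
    induction n with
    | zero => simpa using hx
    | succ n ih => rw [pow_succ']; exact hC _ ih
  refine Subset.antisymm ?_ ?_
  · set G := {x : X | ∃ n : ℕ, ∃ lam : ℝ, ∃ v ∈ P, w < lam ∧
        x = (resolventOp S.A (lam : 𝕜) ^ n) (S.Bop (lam : 𝕜) v)} with hG
    -- The part of the generating set with a fixed `lam`.
    set H : ℝ → Set X := fun lam => {x : X | ∃ n : ℕ, ∃ v ∈ P,
        x = (resolventOp S.A (lam : 𝕜) ^ n) (S.Bop (lam : 𝕜) v)} with hH
    have hHC : ∀ lam, w < lam → IsClosedConvexCone (closedConvexHull ℝ (H lam)) := by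
      intro lam hlam
      refine isClosedConvexCone_closedConvexHull ?_ ?_
      · exact ⟨0, 0, hP.zero_mem, by rw [hB0 _ hlam, map_zero]⟩
      · rintro c hc _ ⟨n, v, hv, rfl⟩
        refine ⟨n, c • v, hP.smul_mem c hc v hv, ?_⟩
        rw [S.Bop_smul (hl _ hlam), ContinuousLinearMap.map_smul_of_tower]
    have hHR : ∀ lam, w < lam → ∀ x ∈ closedConvexHull ℝ (H lam),
        resolventOp S.A (lam : 𝕜) x ∈ closedConvexHull ℝ (H lam) := by
      intro lam hlam x hx
      refine mapsTo_closedConvexHull ((resolventOp S.A (lam : 𝕜)).restrictScalars ℝ)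
        convex_closedConvexHull isClosed_closedConvexHull ?_ hx
      rintro _ ⟨n, v, hv, rfl⟩
      exact subset_closedConvexHull ⟨n + 1, v, hv, by rw [pow_succ']; rfl⟩
    have hHR' : ∀ lam mu, w < mu → mu ≤ lam → ∀ x ∈ closedConvexHull ℝ (H lam),
        resolventOp S.A (mu : 𝕜) x ∈ closedConvexHull ℝ (H lam) := by
      intro lam mu hmu hml x hx
      exact resolventOp_mem_of_le hT hA hb (hw.trans hmu) hml (hHC _ (hmu.trans_le hml))
        (hHR _ (hmu.trans_le hml)) hx
    have hHB : ∀ lam mu, w < mu → mu ≤ lam → ∀ v ∈ P,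
        S.Bop (mu : 𝕜) v ∈ closedConvexHull ℝ (H lam) := by
      intro lam mu hmu hml v hv
      have hlam := hmu.trans_le hml
      have h1 : S.Bop (lam : 𝕜) v ∈ closedConvexHull ℝ (H lam) :=
        subset_closedConvexHull ⟨0, v, hv, by simp⟩
      have h2 : S.Bop (mu : 𝕜) v = S.Bop (lam : 𝕜) v +
          (lam - mu) • resolventOp S.A (mu : 𝕜) (S.Bop (lam : 𝕜) v) := by
        rw [S.Bop_eq_sub (hl _ hlam) (hl _ hmu), RCLike.real_smul_eq_coe_smul (K := 𝕜) (lam - mu),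
          RCLike.ofReal_sub, sub_eq_add_neg, ← neg_smul, neg_sub]
      rw [h2]
      exact (hHC _ hlam).add_mem h1 ((hHC _ hlam).smul_mem _ (sub_nonneg.2 hml) _
        (hHR' lam mu hmu hml _ h1))
    have hHG : ∀ lam, w < lam → closedConvexHull ℝ (H lam) ⊆ closedConvexHull ℝ G := by
      intro lam hlam
      refine (closedConvexHull ℝ).monotone ?_
      rintro _ ⟨n, v, hv, rfl⟩
      exact ⟨n, lam, v, hv, hlam, rfl⟩
    have hGC : IsClosedConvexCone (closedConvexHull ℝ G) := by
      refine isClosedConvexCone_closedConvexHull ?_ ?_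
      · exact ⟨0, w + 1, 0, hP.zero_mem, lt_add_one w, by rw [hB0 _ (lt_add_one w), map_zero]⟩
      · rintro c hc _ ⟨n, lam, v, hv, hlam, rfl⟩
        refine ⟨n, lam, c • v, hP.smul_mem c hc v hv, hlam, ?_⟩
        rw [S.Bop_smul (hl _ hlam), ContinuousLinearMap.map_smul_of_tower]
    have hGR : ∀ mu, w < mu → ∀ x ∈ closedConvexHull ℝ G,
        resolventOp S.A (mu : 𝕜) x ∈ closedConvexHull ℝ G := by
      intro mu hmu x hx
      refine mapsTo_closedConvexHull ((resolventOp S.A (mu : 𝕜)).restrictScalars ℝ)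
        convex_closedConvexHull isClosed_closedConvexHull ?_ hx
      rintro _ ⟨n, lam, v, hv, hlam, rfl⟩
      -- The generator has parameter `lam`, the resolvent `mu`; the cone of the larger parameter
      -- contains `B_lam v` and is invariant under both resolvents.
      have hlm : w < max lam mu := lt_max_of_lt_left hlam
      refine hHG _ hlm (hHR' _ mu hmu (le_max_right _ _) _ ?_)
      exact hpow (hHR' _ lam hlam (le_max_left _ _)) n _
        (hHB _ lam hlam (le_max_left _ _) v hv)
    refine S.approxPosReach_subset_of_orbits hp hP hb (hw.trans (lt_add_one w)) hGC ?_ ?_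
    · intro t ht x hx
      exact semigroup_mem hT hA hb (hw.trans (lt_add_one w)) hGC
        (fun mu hmu => hGR mu (by linarith)) ht hx
    · intro v hv mu hmu
      exact subset_closedConvexHull ⟨0, mu, v, hv, by linarith, by simp⟩
  · have hC := S.isClosedConvexCone_approxPosReach hp hP (hl _ (lt_add_one w))
    refine closedConvexHull_min ?_ hC.convex hC.isClosed
    rintro _ ⟨n, lam, v, hv, hlam, rfl⟩
    refine hpow (fun x hx => resolventOp_mem hT hA hb (hw.trans hlam) hC
      (fun t ht x hx => S.semigroup_mem_approxPosReach hp hP (hl _ hlam) ht hx) hx) n _ ?_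
    exact S.Bop_mem_approxPosReach hp hP hb (hw.trans hlam) hv

end Controls

end BoundaryControlSystem

/-! ### The growth bound and the main theorem -/

theorem exists_bound_of_growthBound_lt {𝕜 X : Type*} [RCLike 𝕜] [NormedAddCommGroup X]
    [NormedSpace 𝕜 X] {T : ℝ → X →L[𝕜] X} {lam : ℝ} (h : growthBound T < (lam : EReal)) :
    ∃ M w : ℝ, (∀ t : ℝ, 0 ≤ t → ‖T t‖ ≤ M * Real.exp (w * t)) ∧ w < lam := by
  obtain ⟨_, ⟨w, ⟨M, hM⟩, rfl⟩, hw⟩ := sInf_lt_iff.1 h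
  exact ⟨M, w, hM, EReal.coe_lt_coe_iff.1 hw⟩

theorem proposition4p2 {𝕜 X Xr dX U Ur : Type*} [RCLike 𝕜]
    [NormedAddCommGroup X] [NormedSpace 𝕜 X] [NormedSpace ℝ X] [IsScalarTower ℝ 𝕜 X]
    [CompleteSpace X]
    [NormedAddCommGroup Xr] [Lattice Xr] [IsOrderedAddMonoid Xr] [HasSolidNorm Xr]
    [NormedSpace ℝ Xr] [IsOrderedModule ℝ Xr] [CompleteSpace Xr]
    [NormedAddCommGroup dX] [NormedSpace 𝕜 dX] [CompleteSpace dX]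
    [NormedAddCommGroup U] [NormedSpace 𝕜 U] [NormedSpace ℝ U] [IsScalarTower ℝ 𝕜 U]
    [CompleteSpace U]
    [NormedAddCommGroup Ur] [Lattice Ur] [IsOrderedAddMonoid Ur] [HasSolidNorm Ur]
    [NormedSpace ℝ Ur] [IsOrderedModule ℝ Ur] [CompleteSpace Ur]
    (LX : BanachLatticeOver 𝕜 X Xr) (LU : BanachLatticeOver 𝕜 U Ur)
    (S : BoundaryControlSystem 𝕜 X dX U)
    (p : ℝ≥0∞) (hp : 1 ≤ p) (hB : S.IsBoundaryAdmissible p)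
    (t₀ : ℝ) (ht₀ : 0 < t₀) (hpos : S.exactPosReach p LU.posCone t₀ ⊆ LX.posCone) :
    -- closed convex cone, invariant under the semigroup and the resolvents
    (IsClosed (S.approxPosReach p LU.posCone) ∧
      Convex ℝ (S.approxPosReach p LU.posCone) ∧
      (0 : X) ∈ S.approxPosReach p LU.posCone ∧
      (∀ c : ℝ, 0 ≤ c → ∀ x ∈ S.approxPosReach p LU.posCone,
        c • x ∈ S.approxPosReach p LU.posCone) ∧
      (∀ t : ℝ, 0 ≤ t → ∀ x ∈ S.approxPosReach p LU.posCone,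
        S.T t x ∈ S.approxPosReach p LU.posCone) ∧
      (∀ lam : ℝ, growthBound S.T < (lam : EReal) → ∀ x ∈ S.approxPosReach p LU.posCone,
        resolventOp S.A (lam : 𝕜) x ∈ S.approxPosReach p LU.posCone)) ∧
    -- first representation, for each `lam > ω₀`
    (∀ lam : ℝ, growthBound S.T < (lam : EReal) →
      S.approxPosReach p LU.posCone = closedConvexHull ℝ
        {x : X | ∃ α β t : ℝ, ∃ v ∈ LU.posCone, 0 ≤ α ∧ α ≤ β ∧ β ≤ t ∧
          x = Real.exp (lam * β) • S.T (t - β) (S.Bop (lam : 𝕜) v)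
            - Real.exp (lam * α) • S.T (t - α) (S.Bop (lam : 𝕜) v)}) ∧
    -- second representation, for each `w > ω₀`
    (∀ w : ℝ, growthBound S.T < (w : EReal) →
      S.approxPosReach p LU.posCone = closedConvexHull ℝ
        {x : X | ∃ t lam : ℝ, ∃ v ∈ LU.posCone, 0 ≤ t ∧ w < lam ∧
          x = S.T t (S.Bop (lam : 𝕜) v)}) ∧
    -- third representation, for each `w > ω₀`
    (∀ w : ℝ, growthBound S.T < (w : EReal) →
      S.approxPosReach p LU.posCone = closedConvexHull ℝ
        {x : X | ∃ n : ℕ, ∃ lam : ℝ, ∃ v ∈ LU.posCone, w < lam ∧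
          x = (resolventOp S.A (lam : 𝕜) ^ n) (S.Bop (lam : 𝕜) v)})
 := by
  have hP := LU.isPointedConvexCone_posCone
  have hT := S.T_semigroup
  have hA := S.isGenerator
  -- The cone property and semigroup invariance come without a given `λ`, so some real point of the
  -- resolvent set has to be produced for them.
  obtain ⟨M₁, w₁, hb₁⟩ := hT.exists_exponential_bound
  have hl₁ := mem_resolventSetOf hT hA hb₁ (lt_add_one w₁)
  have hC := S.isClosedConvexCone_approxPosReach hp hP hl₁
  have hinv : ∀ t : ℝ, 0 ≤ t → ∀ x ∈ S.approxPosReach p LU.posCone,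
      S.T t x ∈ S.approxPosReach p LU.posCone := fun t ht x hx =>
    S.semigroup_mem_approxPosReach hp hP hl₁ ht hx
  refine ⟨⟨hC.isClosed, hC.convex, hC.zero_mem, hC.smul_mem, hinv, ?_⟩, ?_, ?_, ?_⟩
  · intro lam hlam x hx
    obtain ⟨M, w, hb, hw⟩ := exists_bound_of_growthBound_lt hlam
    exact resolventOp_mem hT hA hb hw hC hinv hx
  · intro lam hlam
    obtain ⟨M, w, hb, hw⟩ := exists_bound_of_growthBound_lt hlam
    exact S.approxPosReach_eq hp hP (mem_resolventSetOf hT hA hb hw)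
  · intro w hw
    obtain ⟨M, w₀, hb, hw₀⟩ := exists_bound_of_growthBound_lt hw
    exact S.approxPosReach_eq_orbits hp hP hb hw₀
  · intro w hw
    obtain ⟨M, w₀, hb, hw₀⟩ := exists_bound_of_growthBound_lt hw
    exact S.approxPosReach_eq_resolvents hp hP hb hw₀
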